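/- Fix $n$. Let $\Gamma$ be the full Fock space over $\mathbb C^n$, with orthonormal basis $e_\alpha$ ($\alpha$ in the free monoid $\mathbb F_n^+$ on $n$ generators), vacuum vector $e_\emptyset$, left creation operators $L_j e_\alpha=e_{j\alpha}$ and right creation operators $R_j e_\alpha=e_{\alpha j}$. Let $\mathcal F_n^\infty$ be the WOT-closure of the norm-closed algebra generated by $I,L_1,\dots,L_n$. Let $\mathcal P_J$ be a set of polynomials in $n$ noncommuting variables, let $J$ be the WOT-closed two-sided ideal of $\mathcal F_n^\infty$ generated by $\{p(L_1,\dots,L_n):p\in\mathcal P_J\}$, and put $\mathcal M_J=\overline{\mathrm{span}}\{\varphi\psi:\varphi\in J,\ \psi\in\Gamma\}$, $\mathcal N_J=\Gamma\ominus\mathcal M_J$. Assume $e_\emptyset\in\mathcal N_J$. A tuple $T=(T_1,\dots,T_n)$ of bounded operators on a Hilbert space $\mathcal H$ is a row contraction if the row operator $T:\bigoplus_1^n\mathcal H\to\mathcal H$, $(h_j)\mapsto\sum_j T_jh_j$, is a contraction; it is a ($J$-)constrained row contraction if moreover $p(T_1,\dots,T_n)=0$ for all $p\in\mathcal P_J$.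 For a contraction $X$ put $D_X=(I-X^*X)^{1/2}$ and $\mathcal D_X=\overline{\mathrm{ran}}\,D_X$. The characteristic function of a row contraction $T$ is the operator $\Theta_T:\Gamma\otimes\mathcal D_T\to\Gamma\otimes\mathcal D_{T^*}$, $$\Theta_T=\mathrm{SOT}\text{-}\lim_{r\to1^-}\Big[-I_\Gamma\otimes T+(I_\Gamma\otimes D_{T^*})\,(I-r\tilde R\tilde T^*)^{-1}\,r\tilde R\,(I_\Gamma\otimes D_T)\Big],$$ where $\tilde T=(I_\Gamma\otimes T_1,\dots,I_\Gamma\otimes T_n)$ and $\tilde R=(R_1\otimes I_{\mathcal H},\dots,R_n\otimes I_{\mathcal H})$ are row operators. The constrained characteristic function is $\Theta_{J,T}=P_{\mathcal N_J\otimes\mathcal D_{T^*}}\Theta_T|_{\mathcal N_J\otimes\mathcal D_T}$. A bounded operator $M:\mathcal N_J\otimes\mathcal E\to\mathcal N_J\otimes\mathcal E_*$ is purely contractive if $\|M\|\le1$ and $\|P_{e_\emptyset\otimes\mathcal E_*}M(e_\emptyset\otimes\eta)\|<\|\eta\|$ for all nonzero $\eta\in\mathcal E$. It coincides with $M':\mathcal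 N_J\otimes\mathcal E'\to\mathcal N_J\otimes\mathcal E'_*$ if there are unitary operators $W:\mathcal E\to\mathcal E'$ and $W_*:\mathcal E_*\to\mathcal E'_*$ with $(I_{\mathcal N_J}\otimes W_*)M=M'(I_{\mathcal N_J}\otimes W)$. **Theorem.** Let $\mathcal H_1,\mathcal H_2,\mathcal F,\mathcal F_*$ be complex Hilbert spaces, let $A=(A_1,\dots,A_n)$ on $\mathcal H_1$ and $B=(B_1,\dots,B_n)$ on $\mathcal H_2$ be constrained row contractions, and let $w:\mathcal D_{A^*}\oplus\mathcal F\to\mathcal D_B\oplus\mathcal F_*$ be a unitary operator. Put $L=P_{\mathcal D_{A^*}}w^*|_{\mathcal D_B}:\mathcal D_B\to\mathcal D_{A^*}$ and suppose that $$T=\begin{bmatrix}A&D_{A^*}LD_B\\0&B\end{bmatrix}:\Big(\bigoplus_1^n\mathcal H_1\Big)\oplus\Big(\bigoplus_1^n\mathcal H_2\Big)\to\mathcal H_1\oplus\mathcal H_2$$ is a constrained row contraction on $\mathcal H_1\oplus\mathcal H_2$, and that the operator $$\Theta=\begin{bmatrix}\Theta_{J,B}&0\\0&I_{\mathcal N_J\otimes\mathcal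 F_*}\end{bmatrix}(I_{\mathcal N_J}\otimes w)\begin{bmatrix}\Theta_{J,A}&0\\0&I_{\mathcal N_J\otimes\mathcal F}\end{bmatrix}:\mathcal N_J\otimes(\mathcal D_A\oplus\mathcal F)\to\mathcal N_J\otimes(\mathcal D_{B^*}\oplus\mathcal F_*)$$ is purely contractive. Then $\Theta$ coincides with $\Theta_{J,T}$. -/

import Mathlib

open Topology Filter
open scoped InnerProductSpace

set_option linter.unusedSectionVars false

noncomputable section

namespace RowContraction

universe u

/-! ### The full Fock space, vector valued -/

/-- `Fock n E` is the Hilbert space `Γ ⊗ E`, where `Γ` is the full Fock space over `ℂⁿ`, realised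
through the orthonormal basis `e_α` of `Γ` as the space `ℓ²(𝔽ₙ⁺; E)` of square summable families
indexed by the free monoid on `n` generators: `∑ e_α ⊗ x_α` is the family `α ↦ x_α`. -/
abbrev Fock (n : ℕ) (E : Type u) [NormedAddCommGroup E] : Type u :=
  lp (fun _ : FreeMonoid (Fin n) => E) 2

/-- The full Fock space `Γ` itself. -/
abbrev Gam (n : ℕ) : Type := Fock n ℂ

section Basic

variable {n : ℕ} {E F : Type*} [NormedAddCommGroup E] [InnerProductSpace ℂ E]
  [NormedAddCommGroup F] [InnerProductSpace ℂ F]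

instance : DecidableEq (FreeMonoid (Fin n)) := inferInstanceAs (DecidableEq (List (Fin n)))

theorem two_toReal_pos : 0 < (2 : ENNReal).toReal := by norm_num

theorem summable_sq (f : Fock n E) : Summable fun α => ‖f α‖ ^ (2 : ENNReal).toReal :=
  (lp.memℓp f).summable two_toReal_pos

theorem memlp_map (X : E →L[ℂ] F) (f : Fock n E) :
    Memℓp (fun α : FreeMonoid (Fin n) => X (f α)) 2 := by
  refine memℓp_gen ?_
  refine Summable.of_nonneg_of_le (fun α => by positivity) (fun α => ?_)
    ((summable_sq f).mul_left (‖X‖ ^ (2 : ENNReal).toReal))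
  rw [← Real.mul_rpow (norm_nonneg _) (norm_nonneg _)]
  exact Real.rpow_le_rpow (norm_nonneg _) (X.le_opNorm _) two_toReal_pos.le

/-- The operator `I_Γ ⊗ X : Γ ⊗ E → Γ ⊗ F`, which applies `X` to every coordinate. -/
def ampl (n : ℕ) (X : E →L[ℂ] F) : Fock n E →L[ℂ] Fock n F :=
  LinearMap.mkContinuous
    { toFun := fun f => ⟨fun α => X (f α), memlp_map X f⟩
      map_add' := fun f g => by ext α; exact map_add X (f α) (g α)
      map_smul' := fun c f => by ext α; exact map_smul X c (f α) }
    ‖X‖ (fun f => by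
      refine lp.norm_le_of_tsum_le two_toReal_pos (by positivity) ?_
      rw [Real.mul_rpow (norm_nonneg _) (norm_nonneg _), lp.norm_rpow_eq_tsum two_toReal_pos,
        ← tsum_mul_left]
      refine Summable.tsum_le_tsum (fun α => ?_) ((memlp_map X f).summable two_toReal_pos)
        ((summable_sq f).mul_left _)
      rw [← Real.mul_rpow (norm_nonneg _) (norm_nonneg _)]
      exact Real.rpow_le_rpow (norm_nonneg _) (X.le_opNorm _) two_toReal_pos.le)

@[simp] theorem ampl_apply (X : E →L[ℂ] F) (f : Fock n E) (α : FreeMonoid (Fin n)) :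
    ampl n X f α = X (f α) := rfl

theorem hasSum_extend {s : FreeMonoid (Fin n) → FreeMonoid (Fin n)} (hs : Function.Injective s)
    (f : Fock n E) :
    HasSum (fun α => ‖Function.extend s f 0 α‖ ^ (2 : ENNReal).toReal)
      (‖f‖ ^ (2 : ENNReal).toReal) := by
  refine (hs.hasSum_iff ?_).1 ?_
  · intro α hα
    rw [Function.extend_apply' _ _ _ (by simpa using hα)]
    simp
  · have h : (fun α => ‖Function.extend s f 0 α‖ ^ (2 : ENNReal).toReal) ∘ s
        = fun α => ‖f α‖ ^ (2 : ENNReal).toReal := by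
      funext α
      simp only [Function.comp, hs.extend_apply]
    rw [h]
    exact lp.hasSum_norm two_toReal_pos f

/-- For an injective self-map `s` of the free monoid, the isometry `∑ e_α ⊗ x_α ↦ ∑ e_{s α} ⊗ x_α`
of `Γ ⊗ E`. -/
def shift {s : FreeMonoid (Fin n) → FreeMonoid (Fin n)} (hs : Function.Injective s) :
    Fock n E →ₗᵢ[ℂ] Fock n E where
  toFun f := ⟨Function.extend s f 0, memℓp_gen (hasSum_extend hs f).summable⟩
  map_add' f g := by
    ext α
    by_cases h : ∃ β, s β = α
    · obtain ⟨β, rfl⟩ := h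
      change Function.extend s (⇑f + ⇑g) 0 (s β) =
        Function.extend s (⇑f) 0 (s β) + Function.extend s (⇑g) 0 (s β)
      simp only [hs.extend_apply, Pi.add_apply]
    · change Function.extend s (⇑f + ⇑g) 0 α =
        Function.extend s (⇑f) 0 α + Function.extend s (⇑g) 0 α
      simp only [Function.extend_apply' _ _ _ h, Pi.zero_apply, add_zero]
  map_smul' c f := by
    ext α
    by_cases h : ∃ β, s β = α
    · obtain ⟨β, rfl⟩ := h
      simp [hs.extend_apply]
    · simp [Function.extend_apply' _ _ _ h]
  norm_map' f := by
    have h := hasSum_extend hs f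
    have h2 := lp.norm_rpow_eq_tsum two_toReal_pos
      (⟨Function.extend s f 0, memℓp_gen h.summable⟩ : Fock n E)
    have h3 : ‖(⟨Function.extend s f 0, memℓp_gen h.summable⟩ : Fock n E)‖
        ^ (2 : ENNReal).toReal = ‖f‖ ^ (2 : ENNReal).toReal := h2.trans h.tsum_eq
    exact (Real.rpow_left_inj (norm_nonneg _) (norm_nonneg _) two_toReal_pos.ne').1 h3

theorem shift_apply {s : FreeMonoid (Fin n) → FreeMonoid (Fin n)} (hs : Function.Injective s)
    (f : Fock n E) (α : FreeMonoid (Fin n)) : shift hs f (s α) = f α :=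
  hs.extend_apply _ _ _

theorem shift_apply_of_notMem {s : FreeMonoid (Fin n) → FreeMonoid (Fin n)}
    (hs : Function.Injective s) (f : Fock n E) (α : FreeMonoid (Fin n)) (h : ¬ ∃ β, s β = α) :
    shift hs f α = 0 :=
  Function.extend_apply' _ _ _ h

/-- The left creation operator `L_j ⊗ I_E`, with `L_j e_α = e_{jα}`. -/
def leftCreation (E : Type*) [NormedAddCommGroup E] [InnerProductSpace ℂ E] (j : Fin n) :
    Fock n E →L[ℂ] Fock n E :=
  (shift (mul_right_injective (FreeMonoid.of j))).toContinuousLinearMap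

/-- The right creation operator `R_j ⊗ I_E`, with `R_j e_α = e_{αj}`. -/
def rightCreation (E : Type*) [NormedAddCommGroup E] [InnerProductSpace ℂ E] (j : Fin n) :
    Fock n E →L[ℂ] Fock n E :=
  (shift (mul_left_injective (FreeMonoid.of j))).toContinuousLinearMap

/-- The embedding of the first summand of `E ⊕ F`. -/
def inlL (E F : Type*) [NormedAddCommGroup E] [InnerProductSpace ℂ E]
    [NormedAddCommGroup F] [InnerProductSpace ℂ F] : E →L[ℂ] WithLp 2 (E × F) :=
  (WithLp.prodContinuousLinearEquiv 2 ℂ E F).symm.toContinuousLinearMap ∘L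
    ContinuousLinearMap.inl ℂ E F

/-- The embedding of the second summand of `E ⊕ F`. -/
def inrL (E F : Type*) [NormedAddCommGroup E] [InnerProductSpace ℂ E]
    [NormedAddCommGroup F] [InnerProductSpace ℂ F] : F →L[ℂ] WithLp 2 (E × F) :=
  (WithLp.prodContinuousLinearEquiv 2 ℂ E F).symm.toContinuousLinearMap ∘L
    ContinuousLinearMap.inr ℂ E F

/-- The elementary tensor `f ⊗ η ∈ Γ ⊗ E`, with coordinates `f_α η`. -/
def tens (f : Gam n) (η : E) : Fock n E := ampl n (ContinuousLinearMap.toSpanSingleton ℂ η) f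

@[simp] theorem tens_apply (f : Gam n) (η : E) (α : FreeMonoid (Fin n)) :
    tens f η α = f α • η := rfl

theorem inner_tens (f g : Gam n) (η ξ : E) :
    ⟪tens f η, tens g ξ⟫_ℂ = ⟪f, g⟫_ℂ * ⟪η, ξ⟫_ℂ := by
  rw [lp.inner_eq_tsum, lp.inner_eq_tsum, ← tsum_mul_right]
  refine tsum_congr fun α => ?_
  simp only [tens_apply, inner_smul_left, inner_smul_right, RCLike.inner_apply]
  ring

/-- The vacuum vector `e_∅ ∈ Γ`. -/
def vacuum (n : ℕ) : Gam n := lp.single 2 (1 : FreeMonoid (Fin n)) (1 : ℂ)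

end Basic

/-! ### Row operators and their characteristic functions -/

section Char

variable {n : ℕ} {H K : Type*} [NormedAddCommGroup H] [InnerProductSpace ℂ H] [CompleteSpace H]
  [NormedAddCommGroup K] [InnerProductSpace ℂ K] [CompleteSpace K]

/-- The Hilbert space direct sum of `n` copies of `H`. -/
abbrev Copies (n : ℕ) (H : Type*) : Type _ := PiLp 2 fun _ : Fin n => H

/-- The row operator `(h_1, …, h_n) ↦ ∑ T_j h_j` of an `n`-tuple. -/
def row (T : Fin n → H →L[ℂ] H) : Copies n H →L[ℂ] H :=
  ∑ j, T j ∘L PiLp.proj 2 (fun _ : Fin n => H) j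

/-- The tuple is a row contraction. -/
def IsRowContraction (T : Fin n → H →L[ℂ] H) : Prop := ‖row T‖ ≤ 1

/-- The defect operator `D_X = (I - X* X)^{1/2}`. -/
def defect (X : H →L[ℂ] K) : H →L[ℂ] H := CFC.sqrt (1 - X.adjoint ∘L X)

/-- The defect space, the closure of the range of `D_X`. -/
def defectSpace (X : H →L[ℂ] K) : Submodule ℂ H := (defect X).range.topologicalClosure

instance (X : H →L[ℂ] K) : CompleteSpace (defectSpace X) :=
  inferInstanceAs (CompleteSpace ((defect X).range.topologicalClosure))

/-- `𝒟_T ⊆ H ⊕ ⋯ ⊕ H` for a tuple `T`. -/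
abbrev defT (T : Fin n → H →L[ℂ] H) : Submodule ℂ (Copies n H) := defectSpace (row T)

/-- `𝒟_{T*} ⊆ H` for a tuple `T`. -/
abbrev defTstar (T : Fin n → H →L[ℂ] H) : Submodule ℂ H := defectSpace (row T).adjoint

/-- The row operator `(R_1 ⊗ I_H, …, R_n ⊗ I_H)` on `⊕ⁿ (Γ ⊗ H) = Γ ⊗ (⊕ⁿ H)`. -/
def rightRow (n : ℕ) (H : Type*) [NormedAddCommGroup H] [InnerProductSpace ℂ H] :
    Fock n (Copies n H) →L[ℂ] Fock n H :=
  ∑ j, rightCreation H j ∘L ampl n (PiLp.proj 2 (fun _ : Fin n => H) j)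

/-- `-T̃ + D_{T̃*} (I - r R̃ T̃*)⁻¹ r R̃ D_{T̃} : Γ ⊗ (⊕ⁿ H) → Γ ⊗ H`; for a row contraction and
`0 ≤ r < 1` the operator that is inverted is invertible. -/
def charFullR (T : Fin n → H →L[ℂ] H) (r : ℝ) : Fock n (Copies n H) →L[ℂ] Fock n H :=
  - ampl n (row T) +
    ampl n (defect (row T).adjoint) ∘L
      Ring.inverse (1 - (r : ℂ) • (rightRow n H ∘L ampl n (row T).adjoint)) ∘L
      ((r : ℂ) • rightRow n H) ∘L ampl n (defect (row T))

/-- `Θ_T(rR) : Γ ⊗ 𝒟_T → Γ ⊗ 𝒟_{T*}`. For a row contraction, the operator `charFullR T r` maps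
`Γ ⊗ 𝒟_T` into `Γ ⊗ 𝒟_{T*}`, so that the projection onto `𝒟_{T*}` only restricts the codomain. -/
def charR (T : Fin n → H →L[ℂ] H) (r : ℝ) : Fock n (defT T) →L[ℂ] Fock n (defTstar T) :=
  ampl n (defTstar T).orthogonalProjectionOnto ∘L charFullR T r ∘L ampl n (defT T).subtypeL

/-! The limit that defines the characteristic function of a row contraction exists. -/

theorem adjoint_comp_le {X : H →L[ℂ] K} (hX : ‖X‖ ≤ 1) :
    (0 : H →L[ℂ] H) ≤ 1 - X.adjoint ∘L X := by
  rw [ContinuousLinearMap.nonneg_iff_isPositive, ContinuousLinearMap.isPositive_iff']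
  refine ⟨(IsSelfAdjoint.one _).sub (ContinuousLinearMap.isPositive_adjoint_comp_self X).isSelfAdjoint,
    fun x => ?_⟩
  have h1 : ‖X x‖ ≤ ‖x‖ := (X.le_opNorm x).trans (by nlinarith [norm_nonneg x])
  have h2 : ⟪(1 - X.adjoint ∘L X) x, x⟫_ℂ = ((‖x‖ ^ 2 - ‖X x‖ ^ 2 : ℝ) : ℂ) := by
    simp [ContinuousLinearMap.adjoint_inner_left, inner_self_eq_norm_sq_to_K]
  rw [h2, Complex.zero_le_real]
  nlinarith [norm_nonneg (X x)]

theorem defect_nonneg (X : H →L[ℂ] K) : 0 ≤ defect X := CFC.sqrt_nonneg _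

theorem defect_adjoint (X : H →L[ℂ] K) : (defect X).adjoint = defect X :=
  ((ContinuousLinearMap.nonneg_iff_isPositive _).1 (defect_nonneg X)).isSelfAdjoint.adjoint_eq

theorem defect_mul_self {X : H →L[ℂ] K} (hX : ‖X‖ ≤ 1) :
    defect X * defect X = 1 - X.adjoint ∘L X :=
  CFC.sqrt_mul_sqrt_self _ (adjoint_comp_le hX)

/-- The block diagonal operator on `H ⊕ K`. -/
def blockDiag (a : H →L[ℂ] H) (b : K →L[ℂ] K) :
    WithLp 2 (H × K) →L[ℂ] WithLp 2 (H × K) :=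
  inlL H K ∘L a ∘L WithLp.fstL 2 ℂ H K + inrL H K ∘L b ∘L WithLp.sndL 2 ℂ H K

theorem blockDiag_fst (a : H →L[ℂ] H) (b : K →L[ℂ] K) (x : WithLp 2 (H × K)) :
    (blockDiag a b x).fst = a x.fst := by
  simp [blockDiag, inlL, inrL]

theorem blockDiag_snd (a : H →L[ℂ] H) (b : K →L[ℂ] K) (x : WithLp 2 (H × K)) :
    (blockDiag a b x).snd = b x.snd := by
  simp [blockDiag, inlL, inrL]

theorem commute_of_sq {D M S : H →L[ℂ] H} (hDD : D * D = M) (hD0 : 0 ≤ D)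
    (h : Commute M S) : Commute D S := by
  rw [← CFC.sqrt_unique hDD hD0]
  exact h.cfcₙ_nnreal _

theorem comp_defect {X : H →L[ℂ] K} (hX : ‖X‖ ≤ 1) :
    X ∘L defect X = defect X.adjoint ∘L X := by
  have hX' : ‖X.adjoint‖ ≤ 1 := by simpa using hX
  set D := blockDiag (defect X) (defect X.adjoint) with hD
  set M := blockDiag (1 - X.adjoint ∘L X) (1 - X.adjoint.adjoint ∘L X.adjoint) with hM
  set S : WithLp 2 (H × K) →L[ℂ] WithLp 2 (H × K) :=
    inrL H K ∘L X ∘L WithLp.fstL 2 ℂ H K with hS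
  have hext : ∀ y z : WithLp 2 (H × K), y.fst = z.fst → y.snd = z.snd → y = z :=
    fun y z h1 h2 => WithLp.ofLp_injective 2 (Prod.ext h1 h2)
  have hDD : D * D = M := by
    refine ContinuousLinearMap.ext fun x => hext _ _ ?_ ?_
    · have := congrArg (fun Z : H →L[ℂ] H => Z x.fst) (defect_mul_self hX)
      change ((D (D x)).fst) = (M x).fst
      rw [hD, hM, blockDiag_fst, blockDiag_fst, blockDiag_fst]
      exact this
    · have := congrArg (fun Z : K →L[ℂ] K => Z x.snd) (defect_mul_self hX')
      change ((D (D x)).snd) = (M x).snd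
      rw [hD, hM, blockDiag_snd, blockDiag_snd, blockDiag_snd]
      exact this
  have hD0 : 0 ≤ D := by
    have p1 := (ContinuousLinearMap.nonneg_iff_isPositive _).1 (defect_nonneg X)
    have p2 := (ContinuousLinearMap.nonneg_iff_isPositive _).1 (defect_nonneg X.adjoint)
    rw [ContinuousLinearMap.nonneg_iff_isPositive, ContinuousLinearMap.isPositive_def]
    refine ⟨fun x y => ?_, fun x => ?_⟩
    · change ⟪D x, y⟫_ℂ = ⟪x, D y⟫_ℂ
      rw [WithLp.prod_inner_apply, WithLp.prod_inner_apply]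
      have e1 := p1.isSymmetric x.fst y.fst
      have e2 := p2.isSymmetric x.snd y.snd
      exact congrArg₂ (· + ·)
        (by change ⟪(D x).fst, y.fst⟫_ℂ = ⟪x.fst, (D y).fst⟫_ℂ
            rw [hD, blockDiag_fst, blockDiag_fst]; exact e1)
        (by change ⟪(D x).snd, y.snd⟫_ℂ = ⟪x.snd, (D y).snd⟫_ℂ
            rw [hD, blockDiag_snd, blockDiag_snd]; exact e2)
    · have e1 := p1.re_inner_nonneg_left x.fst
      have e2 := p2.re_inner_nonneg_left x.snd
      rw [ContinuousLinearMap.reApplyInnerSelf_apply, WithLp.prod_inner_apply, map_add]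
      refine add_nonneg ?_ ?_
      · change 0 ≤ RCLike.re ⟪(D x).fst, x.fst⟫_ℂ
        rw [hD, blockDiag_fst]; exact e1
      · change 0 ≤ RCLike.re ⟪(D x).snd, x.snd⟫_ℂ
        rw [hD, blockDiag_snd]; exact e2
  have hcomm : Commute M S := by
    refine ContinuousLinearMap.ext fun x => hext _ _ ?_ ?_
    · change (M (S x)).fst = (S (M x)).fst
      rw [hM, blockDiag_fst]
      simp [hS, inrL]
    · change (M (S x)).snd = (S (M x)).snd
      rw [hM, blockDiag_snd]
      change (1 - X.adjoint.adjoint ∘L X.adjoint) (S x).snd = X (blockDiag _ _ x).fst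
      rw [blockDiag_fst]
      simp [hS, inrL]
  have h2 : Commute D S := commute_of_sq hDD hD0 hcomm
  ext x
  have h3 := congrArg (fun Z => (Z (WithLp.toLp 2 (x, (0 : K)))).snd) h2.eq
  have h4 : (D (S (WithLp.toLp 2 (x, (0 : K))))).snd = (S (D (WithLp.toLp 2 (x, (0 : K))))).snd := h3
  rw [hD, blockDiag_snd] at h4
  have hf := blockDiag_fst (defect X) (defect X.adjoint) (WithLp.toLp 2 (x, (0 : K)))
  simp [hS, inrL, hf] at h4
  exact h4.symm

theorem norm_sq_defect {X : H →L[ℂ] K} (hX : ‖X‖ ≤ 1) (x : H) :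
    ‖defect X x‖ ^ 2 = ‖x‖ ^ 2 - ‖X x‖ ^ 2 := by
  have e := congrArg (fun Z : H →L[ℂ] H => ⟪Z x, x⟫_ℂ) (defect_mul_self hX)
  have e' : ⟪defect X (defect X x), x⟫_ℂ = ⟪x - X.adjoint (X x), x⟫_ℂ := e
  have e1 : ⟪defect X (defect X x), x⟫_ℂ = ⟪defect X x, defect X x⟫_ℂ := by
    rw [← ContinuousLinearMap.adjoint_inner_right, defect_adjoint]
  rw [inner_sub_left, ContinuousLinearMap.adjoint_inner_left, e1] at e'
  have h2 := congrArg RCLike.re e'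
  rw [map_sub, inner_self_eq_norm_sq, inner_self_eq_norm_sq, inner_self_eq_norm_sq] at h2
  exact h2

theorem julia {X : H →L[ℂ] K} (hX : ‖X‖ ≤ 1) (h : K) (x : H) :
    ‖X.adjoint h + defect X x‖ ^ 2 + ‖defect X.adjoint h - X x‖ ^ 2 = ‖h‖ ^ 2 + ‖x‖ ^ 2 := by
  have hX' : ‖X.adjoint‖ ≤ 1 := by simpa using hX
  have h1 := norm_sq_defect hX x
  have h2 := norm_sq_defect hX' h
  have h3 : ⟪X.adjoint h, defect X x⟫_ℂ = ⟪defect X.adjoint h, X x⟫_ℂ := by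
    have e1 : ⟪defect X.adjoint h, X x⟫_ℂ = ⟪h, defect X.adjoint (X x)⟫_ℂ := by
      rw [← ContinuousLinearMap.adjoint_inner_right, defect_adjoint]
    rw [ContinuousLinearMap.adjoint_inner_left, e1]
    exact congrArg (fun Z : H →L[ℂ] K => ⟪h, Z x⟫_ℂ) (comp_defect hX)
  rw [norm_add_sq (𝕜 := ℂ), norm_sub_sq (𝕜 := ℂ), h3]
  linarith

theorem norm_sq_eq_tsum {E : Type*} [NormedAddCommGroup E] (f : Fock n E) :
    HasSum (fun α => ‖f α‖ ^ 2) (‖f‖ ^ 2) := by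
  simpa using lp.hasSum_norm two_toReal_pos f

theorem norm_sq_rightRow (f : Fock n (Copies n H)) : ‖rightRow n H f‖ = ‖f‖ := by
  set u : Fin n → Fock n H := fun j =>
    rightCreation H j (ampl n (PiLp.proj 2 (fun _ : Fin n => H) j) f) with hu
  have h0 : rightRow n H f = ∑ j, u j := by
    simp [rightRow, hu]
  have horth : ∀ i j, i ≠ j → ⟪u i, u j⟫_ℂ = 0 := by
    intro i j hij
    rw [lp.inner_eq_tsum]
    refine (tsum_congr fun α => ?_).trans tsum_zero
    by_cases h : ∃ β, β * FreeMonoid.of i = α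
    · have h' : ¬ ∃ β, β * FreeMonoid.of j = α := by
        rintro ⟨γ, hγ⟩
        obtain ⟨β, rfl⟩ := h
        have := congrArg (fun w : FreeMonoid (Fin n) => (FreeMonoid.toList w).getLast?) hγ
        simp at this
        exact hij this.symm
      have : u j α = 0 := shift_apply_of_notMem (mul_left_injective (FreeMonoid.of j)) _ α h'
      rw [this, inner_zero_right]
    · have : u i α = 0 := shift_apply_of_notMem (mul_left_injective (FreeMonoid.of i)) _ α h
      rw [this, inner_zero_left]
  have h1 : ‖∑ j, u j‖ ^ 2 = ∑ j, ‖u j‖ ^ 2 := by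
    have : (⟪∑ j, u j, ∑ j, u j⟫_ℂ) = ∑ j, ⟪u j, u j⟫_ℂ := by
      rw [sum_inner]
      refine Finset.sum_congr rfl fun i _ => ?_
      rw [inner_sum]
      exact Finset.sum_eq_single i (fun j _ hj => horth i j hj.symm) (by simp)
    have h := congrArg RCLike.re this
    rw [map_sum, inner_self_eq_norm_sq] at h
    rw [h]
    exact Finset.sum_congr rfl fun j _ => inner_self_eq_norm_sq _
  have h2 : ∀ j, HasSum (fun α => ‖f α j‖ ^ 2) (‖u j‖ ^ 2) := by
    intro j
    have hj : ‖u j‖ = ‖ampl n (PiLp.proj 2 (fun _ : Fin n => H) j) f‖ :=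
      (shift (mul_left_injective (FreeMonoid.of j))).norm_map _
    rw [hj]
    exact norm_sq_eq_tsum (ampl n (PiLp.proj 2 (fun _ : Fin n => H) j) f)
  have h3 : HasSum (fun α => ‖f α‖ ^ 2) (∑ j, ‖u j‖ ^ 2) := by
    have := hasSum_sum (s := Finset.univ) fun j _ => h2 j
    simpa only [PiLp.norm_sq_eq_of_L2] using this
  have h4 := h3.unique (norm_sq_eq_tsum f)
  rw [h0, ← Real.sqrt_sq (norm_nonneg (∑ j, u j)), h1, h4, Real.sqrt_sq (norm_nonneg _)]

theorem norm_ampl_le {E F : Type*} [NormedAddCommGroup E] [InnerProductSpace ℂ E]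
    [NormedAddCommGroup F] [InnerProductSpace ℂ F] (X : E →L[ℂ] F) : ‖ampl n X‖ ≤ ‖X‖ :=
  LinearMap.mkContinuous_norm_le _ (norm_nonneg _) _

theorem isUnit_resolvent {T : Fin n → H →L[ℂ] H} (hT : IsRowContraction T) {r : ℝ} (h0 : 0 ≤ r)
    (h1 : r < 1) : IsUnit (1 - (r : ℂ) • (rightRow n H ∘L ampl n (row T).adjoint)) := by
  refine isUnit_one_sub_of_norm_lt_one ?_
  have hR : ‖rightRow n H‖ ≤ 1 :=
    ContinuousLinearMap.opNorm_le_bound _ zero_le_one fun f => by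
      rw [norm_sq_rightRow, one_mul]
  have hA : ‖ampl n (row T).adjoint‖ ≤ 1 :=
    (norm_ampl_le _).trans ((LinearIsometryEquiv.norm_map _ _).trans_le hT)
  have hRA : ‖rightRow n H ∘L ampl n (row T).adjoint‖ ≤ 1 :=
    (ContinuousLinearMap.opNorm_comp_le _ _).trans
      (mul_le_one₀ hR (norm_nonneg _) hA)
  rw [norm_smul, Complex.norm_real, Real.norm_of_nonneg h0]
  nlinarith [norm_nonneg (rightRow n H ∘L ampl n (row T).adjoint)]

theorem norm_charFullR_le {T : Fin n → H →L[ℂ] H} (hT : IsRowContraction T) {r : ℝ} (h0 : 0 ≤ r)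
    (h1 : r < 1) (x : Fock n (Copies n H)) : ‖charFullR T r x‖ ≤ ‖x‖ := by
  set y := ampl n (defect (row T)) x with hy
  set h := Ring.inverse (1 - (r : ℂ) • (rightRow n H ∘L ampl n (row T).adjoint))
    (((r : ℂ) • rightRow n H) y) with hh
  have e1 : h - (r : ℂ) • rightRow n H (ampl n (row T).adjoint h) = (r : ℂ) • rightRow n H y := by
    have := congrArg (fun Z => Z (((r : ℂ) • rightRow n H) y))
      (Ring.mul_inverse_cancel _ (isUnit_resolvent hT h0 h1))
    exact this
  have e2 : h = (r : ℂ) • rightRow n H (ampl n (row T).adjoint h + y) := by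
    rw [map_add, smul_add, ← e1]; abel
  have e3 : ‖h‖ ≤ ‖ampl n (row T).adjoint h + y‖ := by
    have := congrArg norm e2
    rw [norm_smul, norm_sq_rightRow, Complex.norm_real, Real.norm_of_nonneg h0] at this
    rw [this]
    exact mul_le_of_le_one_left (norm_nonneg _) h1.le
  have e4 : charFullR T r x = ampl n (defect (row T).adjoint) h - ampl n (row T) x := by
    change - ampl n (row T) x + ampl n (defect (row T).adjoint) h = _
    abel
  have e5 : ‖ampl n (row T).adjoint h + y‖ ^ 2 + ‖charFullR T r x‖ ^ 2 = ‖h‖ ^ 2 + ‖x‖ ^ 2 := by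
    rw [e4]
    have s1 := (norm_sq_eq_tsum (ampl n (row T).adjoint h + y)).add
      (norm_sq_eq_tsum (ampl n (defect (row T).adjoint) h - ampl n (row T) x))
    have s2 := (norm_sq_eq_tsum h).add (norm_sq_eq_tsum x)
    have s3 : (fun α => ‖(ampl n (row T).adjoint h + y) α‖ ^ 2 +
        ‖(ampl n (defect (row T).adjoint) h - ampl n (row T) x) α‖ ^ 2) =
        fun α => ‖h α‖ ^ 2 + ‖x α‖ ^ 2 := funext fun α => julia hT (h α) (x α)
    rw [s3] at s1
    exact s1.unique s2
  have e6 : ‖charFullR T r x‖ ^ 2 ≤ ‖x‖ ^ 2 := by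
    have := pow_le_pow_left₀ (norm_nonneg _) e3 2
    linarith
  exact (pow_le_pow_iff_left₀ (norm_nonneg _) (norm_nonneg _) two_ne_zero).1 e6

/-- `charFullR T r` maps `Γ ⊗ 𝒟_T` into `Γ ⊗ 𝒟_{T*}`. -/
theorem charFullR_mem {T : Fin n → H →L[ℂ] H} (hT : IsRowContraction T) (r : ℝ)
    (x : Fock n (defT T)) (α : FreeMonoid (Fin n)) :
    charFullR T r (ampl n (defT T).subtypeL x) α ∈ defTstar T := by
  have hc : IsClosed (((defTstar T).comap (row T : Copies n H →ₗ[ℂ] H)) : Set (Copies n H)) :=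
    (Submodule.isClosed_topologicalClosure _).preimage (row T).continuous
  have hle : defT T ≤ (defTstar T).comap (row T : Copies n H →ₗ[ℂ] H) := by
    refine Submodule.topologicalClosure_minimal _ ?_ hc
    rintro _ ⟨z, rfl⟩
    change row T (defect (row T) z) ∈ defTstar T
    have := congrArg (fun Z : Copies n H →L[ℂ] H => Z z) (comp_defect hT)
    change row T (defect (row T) z) = defect (row T).adjoint (row T z) at this
    rw [this]
    exact Submodule.le_topologicalClosure _ (LinearMap.mem_range_self _ _)
  refine add_mem (neg_mem (hle (x α).2)) ?_
  exact Submodule.le_topologicalClosure _ (LinearMap.mem_range_self _ _)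

section Damp

variable {E F : Type*} [NormedAddCommGroup E] [InnerProductSpace ℂ E]
  [NormedAddCommGroup F] [InnerProductSpace ℂ F]

theorem norm_damp_le {s : ℝ} (h0 : 0 ≤ s) (h1 : s ≤ 1) (k : ℕ) (x : E) :
    ‖((s : ℂ) ^ k) • x‖ ≤ ‖x‖ := by
  rw [norm_smul, norm_pow, Complex.norm_real, Real.norm_of_nonneg h0]
  exact mul_le_of_le_one_left (norm_nonneg _) (pow_le_one₀ h0 h1)

theorem memlp_of_norm_le {f : Fock n E} {g : FreeMonoid (Fin n) → E} (h : ∀ α, ‖g α‖ ≤ ‖f α‖) :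
    Memℓp g 2 :=
  memℓp_gen (Summable.of_nonneg_of_le (fun _ => by positivity)
    (fun α => Real.rpow_le_rpow (norm_nonneg _) (h α) two_toReal_pos.le) (summable_sq f))

theorem norm_le_of_coord {f : Fock n E} {g : Fock n F} (h : ∀ α, ‖g α‖ ≤ ‖f α‖) :
    ‖g‖ ≤ ‖f‖ := by
  have := hasSum_le (fun α => pow_le_pow_left₀ (norm_nonneg _) (h α) 2) (norm_sq_eq_tsum g)
    (norm_sq_eq_tsum f)
  exact (pow_le_pow_iff_left₀ (norm_nonneg _) (norm_nonneg _) two_ne_zero).1 this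

/-- The operator `e_α ⊗ x ↦ s^{|α|} e_α ⊗ x`. -/
def damp {s : ℝ} (h0 : 0 ≤ s) (h1 : s ≤ 1) : Fock n E →L[ℂ] Fock n E :=
  LinearMap.mkContinuous
    { toFun := fun f => ⟨fun α => ((s : ℂ) ^ α.length) • f α,
        memlp_of_norm_le fun α => norm_damp_le h0 h1 _ _⟩
      map_add' := fun f g => by ext α; exact smul_add _ (f α) (g α)
      map_smul' := fun c f => by ext α; exact smul_comm _ c (f α) }
    1 (fun f => by
      rw [one_mul]
      exact norm_le_of_coord fun α => norm_damp_le h0 h1 _ _)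

theorem damp_apply {s : ℝ} (h0 : 0 ≤ s) (h1 : s ≤ 1) (f : Fock n E) (α : FreeMonoid (Fin n)) :
    damp h0 h1 f α = ((s : ℂ) ^ α.length) • f α := rfl

theorem ampl_damp {s : ℝ} (h0 : 0 ≤ s) (h1 : s ≤ 1) (X : E →L[ℂ] F) (f : Fock n E) :
    ampl n X (damp h0 h1 f) = damp h0 h1 (ampl n X f) := by
  ext α
  exact map_smul X _ (f α)

theorem rightCreation_damp {s : ℝ} (h0 : 0 ≤ s) (h1 : s ≤ 1) (j : Fin n) (f : Fock n E) :
    damp h0 h1 (rightCreation E j f) = (s : ℂ) • rightCreation E j (damp h0 h1 f) := by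
  have hs : Function.Injective fun β : FreeMonoid (Fin n) => β * FreeMonoid.of j :=
    mul_left_injective _
  ext α
  change ((s : ℂ) ^ α.length) • shift hs f α = (s : ℂ) • shift hs (damp h0 h1 f) α
  by_cases h : ∃ β, β * FreeMonoid.of j = α
  · obtain ⟨β, rfl⟩ := h
    have e1 := shift_apply hs f β
    have e2 := shift_apply hs (damp h0 h1 f) β
    simp only at e1 e2
    rw [e1, e2, damp_apply, smul_smul, FreeMonoid.length_mul, FreeMonoid.length_of, pow_succ']
  · rw [shift_apply_of_notMem hs _ _ h, shift_apply_of_notMem hs _ _ h, smul_zero, smul_zero]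

theorem damp_single {s : ℝ} (h0 : 0 ≤ s) (h1 : s ≤ 1) (β : FreeMonoid (Fin n)) (x : E) :
    damp h0 h1 (lp.single 2 β x : Fock n E) = ((s : ℂ) ^ β.length) • lp.single 2 β x := by
  ext α
  change ((s : ℂ) ^ α.length) • (lp.single 2 β x : Fock n E) α =
    ((s : ℂ) ^ β.length) • (lp.single 2 β x : Fock n E) α
  by_cases h : α = β
  · rw [h]
  · rw [lp.single_apply_ne _ _ _ h, smul_zero, smul_zero]

theorem tendsto_damp (c : Fock n E) (g : ℝ → Fock n E)
    (hg : ∀ᶠ r : ℝ in 𝓝[<] 1, ∀ α, g r α = ((r : ℂ) ^ α.length) • c α) :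
    Tendsto g (𝓝[<] 1) (𝓝 c) := by
  have hev : ∀ᶠ r : ℝ in 𝓝[<] 1, r ∈ Set.Ioo (0 : ℝ) 1 := Ioo_mem_nhdsLT zero_lt_one
  have hsum : ∀ᶠ r : ℝ in 𝓝[<] 1,
      ‖g r - c‖ ^ 2 = ∑' α, ((1 - r ^ α.length) * ‖c α‖) ^ 2 := by
    filter_upwards [hg, hev] with r hr hr01
    rw [← (norm_sq_eq_tsum (g r - c)).tsum_eq]
    refine tsum_congr fun α => ?_
    have e1 : (g r - c) α = -(((1 - r ^ α.length : ℝ) : ℂ) • c α) := by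
      change g r α - c α = _
      rw [hr α]
      push_cast
      rw [sub_smul, one_smul]
      abel
    have e2 : 0 ≤ 1 - r ^ α.length := sub_nonneg.2 (pow_le_one₀ hr01.1.le hr01.2.le)
    rw [e1, norm_neg, norm_smul, Complex.norm_real, Real.norm_of_nonneg e2]
  have hlim : Tendsto (fun r : ℝ => ∑' α : FreeMonoid (Fin n), ((1 - r ^ α.length) * ‖c α‖) ^ 2)
      (𝓝[<] 1) (𝓝 (∑' _ : FreeMonoid (Fin n), (0 : ℝ))) := by
    refine tendsto_tsum_of_dominated_convergence (bound := fun α => ‖c α‖ ^ 2)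
      (norm_sq_eq_tsum c).summable (fun α => ?_) ?_
    · have hc : Continuous fun r : ℝ => ((1 - r ^ α.length) * ‖c α‖) ^ 2 := by fun_prop
      have := (hc.tendsto 1).mono_left (nhdsWithin_le_nhds (s := Set.Iio 1))
      simpa using this
    · filter_upwards [hev] with r hr α
      have e1 : 0 ≤ 1 - r ^ α.length := sub_nonneg.2 (pow_le_one₀ hr.1.le hr.2.le)
      have e2 : 1 - r ^ α.length ≤ 1 := by
        have := pow_nonneg hr.1.le α.length
        linarith
      rw [Real.norm_of_nonneg (sq_nonneg _)]
      exact pow_le_pow_left₀ (mul_nonneg e1 (norm_nonneg _))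
        (mul_le_of_le_one_left (norm_nonneg _) e2) 2
  rw [tsum_zero] at hlim
  have h2 : Tendsto (fun r => ‖g r - c‖ ^ 2) (𝓝[<] 1) (𝓝 0) :=
    hlim.congr' (hsum.mono fun r hr => hr.symm)
  rw [tendsto_iff_norm_sub_tendsto_zero]
  have h3 := h2.sqrt
  simpa [Real.sqrt_sq (norm_nonneg _)] using h3

end Damp

theorem rightRow_damp {s : ℝ} (h0 : 0 ≤ s) (h1 : s ≤ 1) (f : Fock n (Copies n H)) :
    damp h0 h1 (rightRow n H f) = (s : ℂ) • rightRow n H (damp h0 h1 f) := by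
  have e : ∀ g : Fock n (Copies n H), rightRow n H g =
      ∑ j, rightCreation H j (ampl n (PiLp.proj 2 (fun _ : Fin n => H) j) g) := fun g => by
    simp [rightRow]
  rw [e, e, map_sum, Finset.smul_sum]
  refine Finset.sum_congr rfl fun j _ => ?_
  rw [rightCreation_damp, ampl_damp]

theorem charFullR_damp {T : Fin n → H →L[ℂ] H} (hT : IsRowContraction T) {r s : ℝ} (hr0 : 0 ≤ r)
    (hr1 : r < 1) (h0 : 0 ≤ s) (h1 : s ≤ 1) (x : Fock n (Copies n H)) :
    charFullR T (r * s) (damp h0 h1 x) = damp h0 h1 (charFullR T r x) := by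
  set Z : ℝ → Fock n H →L[ℂ] Fock n H := fun q =>
    1 - (q : ℂ) • (rightRow n H ∘L ampl n (row T).adjoint) with hZ
  have hrs0 : 0 ≤ r * s := mul_nonneg hr0 h0
  have hrs1 : r * s < 1 := (mul_le_of_le_one_right hr0 h1).trans_lt hr1
  have hcomm : ∀ y, Z (r * s) (damp h0 h1 y) = damp h0 h1 (Z r y) := by
    intro y
    change damp h0 h1 y - ((r * s : ℝ) : ℂ) • rightRow n H (ampl n (row T).adjoint (damp h0 h1 y))
      = damp h0 h1 (y - (r : ℂ) • rightRow n H (ampl n (row T).adjoint y))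
    rw [map_sub, map_smul, rightRow_damp, ampl_damp, smul_smul]
    push_cast
    rfl
  have hinv : ∀ y, Ring.inverse (Z (r * s)) (damp h0 h1 y) = damp h0 h1 (Ring.inverse (Z r) y) := by
    intro y
    have e1 : Z r (Ring.inverse (Z r) y) = y :=
      congrArg (fun X => X y) (Ring.mul_inverse_cancel _ (isUnit_resolvent hT hr0 hr1))
    have e2 : ∀ u, Ring.inverse (Z (r * s)) (Z (r * s) u) = u := fun u =>
      congrArg (fun X => X u) (Ring.inverse_mul_cancel _ (isUnit_resolvent hT hrs0 hrs1))
    nth_rewrite 1 [← e1]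
    rw [← hcomm, e2]
  change - ampl n (row T) (damp h0 h1 x) + ampl n (defect (row T).adjoint)
      (Ring.inverse (Z (r * s)) (((r * s : ℝ) : ℂ) •
        rightRow n H (ampl n (defect (row T)) (damp h0 h1 x)))) =
    damp h0 h1 (- ampl n (row T) x + ampl n (defect (row T).adjoint)
      (Ring.inverse (Z r) ((r : ℂ) • rightRow n H (ampl n (defect (row T)) x))))
  have e3 : ((r * s : ℝ) : ℂ) • rightRow n H (ampl n (defect (row T)) (damp h0 h1 x)) =
      damp h0 h1 ((r : ℂ) • rightRow n H (ampl n (defect (row T)) x)) := by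
    rw [map_smul, rightRow_damp, ampl_damp, smul_smul]
    push_cast
    rfl
  rw [e3, hinv, ampl_damp, ampl_damp, map_add, map_neg]

theorem charR_damp {T : Fin n → H →L[ℂ] H} (hT : IsRowContraction T) {r s : ℝ} (hr0 : 0 ≤ r)
    (hr1 : r < 1) (h0 : 0 ≤ s) (h1 : s ≤ 1) (x : Fock n (defT T)) :
    charR T (r * s) (damp h0 h1 x) = damp h0 h1 (charR T r x) := by
  change ampl n (defTstar T).orthogonalProjectionOnto (charFullR T (r * s)
      (ampl n (defT T).subtypeL (damp h0 h1 x))) = damp h0 h1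
        (ampl n (defTstar T).orthogonalProjectionOnto (charFullR T r
          (ampl n (defT T).subtypeL x)))
  rw [ampl_damp, charFullR_damp hT hr0 hr1, ampl_damp]

theorem norm_charR_le {T : Fin n → H →L[ℂ] H} (hT : IsRowContraction T) {r : ℝ} (h0 : 0 ≤ r)
    (h1 : r < 1) (x : Fock n (defT T)) : ‖charR T r x‖ ≤ ‖x‖ := by
  have e1 : ‖charR T r x‖ ≤ ‖charFullR T r (ampl n (defT T).subtypeL x)‖ :=
    norm_le_of_coord fun α => (defTstar T).norm_orthogonalProjectionOnto_apply_le _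
  have e2 : ‖ampl n (defT T).subtypeL x‖ ≤ ‖x‖ := norm_le_of_coord fun α => le_rfl
  exact e1.trans ((norm_charFullR_le hT h0 h1 _).trans e2)

theorem charR_single_tendsto {T : Fin n → H →L[ℂ] H} (hT : IsRowContraction T)
    (β : FreeMonoid (Fin n)) (η : defT T) :
    ∃ c, Tendsto (fun r : ℝ => charR T r (lp.single 2 β η : Fock n (defT T))) (𝓝[<] 1) (𝓝 c) := by
  set x : Fock n (defT T) := lp.single 2 β η with hx
  set k := β.length with hk
  have hev : ∀ᶠ r : ℝ in 𝓝[<] 1, r ∈ Set.Ioo (1 / 2 : ℝ) 1 := Ioo_mem_nhdsLT (by norm_num)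
  let c : FreeMonoid (Fin n) → defTstar T := fun α =>
    ((2 : ℂ) ^ α.length / 2 ^ k) • charR T (1 / 2) x α
  have hkey : ∀ r : ℝ, r ∈ Set.Ioo (1 / 2 : ℝ) 1 → ∀ α,
      ((r : ℂ) ^ k) • charR T r x α = ((r : ℂ) ^ α.length) • c α := by
    intro r hr α
    have hr0 : (0 : ℝ) < r := by linarith [hr.1]
    have hs0 : (0 : ℝ) ≤ 1 / (2 * r) := by positivity
    have hs1 : 1 / (2 * r) ≤ 1 := by
      rw [div_le_one (by positivity)]; linarith [hr.1]
    have e := charR_damp hT hr0.le hr.2 hs0 hs1 x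
    rw [hx, damp_single, map_smul, ← hx, ← hk] at e
    have e1 : r * (1 / (2 * r)) = 1 / 2 := by field_simp
    rw [e1] at e
    have e2 : (((1 / (2 * r) : ℝ) : ℂ) ^ k) • charR T (1 / 2) x α =
        (((1 / (2 * r) : ℝ) : ℂ) ^ α.length) • charR T r x α :=
      congrArg (fun f : Fock n (defTstar T) => f α) e
    have hrc : (r : ℂ) ≠ 0 := by exact_mod_cast hr0.ne'
    have e3 : charR T r x α = ((2 * r : ℂ) ^ α.length / (2 * r : ℂ) ^ k) •
        charR T (1 / 2) x α := by
      have e4 := congrArg (fun z => ((2 * r : ℂ) ^ α.length) • z) e2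
      simp only [smul_smul] at e4
      push_cast at e4
      rw [← mul_pow (2 * r : ℂ), mul_one_div_cancel (by simpa using hrc), one_pow, one_smul] at e4
      rw [← e4]
      congr 1
      rw [div_pow, one_pow]
      ring
    rw [e3]
    simp only [c, smul_smul]
    congr 1
    rw [mul_pow, mul_pow]
    field_simp
  have hbound : ∀ S : Finset (FreeMonoid (Fin n)), ∑ α ∈ S, ‖c α‖ ^ 2 ≤ ‖x‖ ^ 2 := by
    intro S
    have hcont : Continuous fun r : ℝ => ∑ α ∈ S, (r ^ α.length * ‖c α‖) ^ 2 := by fun_prop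
    have hlim := (hcont.tendsto 1).mono_left (nhdsWithin_le_nhds (s := Set.Iio 1))
    simp only [one_pow, one_mul] at hlim
    refine le_of_tendsto hlim ?_
    filter_upwards [hev] with r hr
    have hr0 : (0 : ℝ) < r := by linarith [hr.1]
    calc ∑ α ∈ S, (r ^ α.length * ‖c α‖) ^ 2
        ≤ ∑ α ∈ S, ‖charR T r x α‖ ^ 2 := by
          refine Finset.sum_le_sum fun α _ => ?_
          have := congrArg norm (hkey r hr α)
          rw [norm_smul ((r : ℂ) ^ α.length), norm_pow, Complex.norm_real,
            Real.norm_of_nonneg hr0.le] at this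
          rw [← this]
          exact pow_le_pow_left₀ (norm_nonneg _) (norm_damp_le hr0.le hr.2.le _ _) 2
      _ ≤ ‖charR T r x‖ ^ 2 :=
          sum_le_hasSum S (fun α _ => by positivity) (norm_sq_eq_tsum _)
      _ ≤ ‖x‖ ^ 2 := pow_le_pow_left₀ (norm_nonneg _) (norm_charR_le hT hr0.le hr.2 x) 2
  have hmem : Memℓp c 2 := memℓp_gen <| by
    simpa using summable_of_sum_le (fun α => by positivity) hbound
  let C : Fock n (defTstar T) := ⟨c, hmem⟩
  have h1 : Tendsto (fun r : ℝ => ((r : ℂ) ^ k) • charR T r x) (𝓝[<] 1) (𝓝 C) := by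
    refine tendsto_damp C _ ?_
    filter_upwards [hev] with r hr α
    exact hkey r hr α
  have h2 : Tendsto (fun r : ℝ => ((r : ℂ) ^ k)⁻¹) (𝓝[<] 1) (𝓝 1) := by
    have hc : ContinuousAt (fun r : ℝ => ((r : ℂ) ^ k)⁻¹) 1 := by
      refine ContinuousAt.inv₀ (by fun_prop) (by simp)
    have := hc.tendsto.mono_left (nhdsWithin_le_nhds (s := Set.Iio 1))
    simpa using this
  refine ⟨C, ?_⟩
  have h3 := h2.smul h1
  rw [one_smul] at h3
  refine h3.congr' ?_
  filter_upwards [hev] with r hr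
  have hr0 : (r : ℂ) ^ k ≠ 0 := pow_ne_zero _ (by
    have : (0 : ℝ) < r := by linarith [hr.1]
    exact_mod_cast this.ne')
  rw [smul_smul, inv_mul_cancel₀ hr0, one_smul]

theorem charR_tendsto {T : Fin n → H →L[ℂ] H} (hT : IsRowContraction T) (x : Fock n (defT T)) :
    ∃ c, Tendsto (fun r : ℝ => charR T r x) (𝓝[<] 1) (𝓝 c) := by
  let V : Submodule ℂ (Fock n (defT T)) :=
    { carrier := {x | ∃ c, Tendsto (fun r : ℝ => charR T r x) (𝓝[<] 1) (𝓝 c)}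
      zero_mem' := ⟨0, by simp⟩
      add_mem' := by
        rintro a b ⟨c, hc⟩ ⟨d, hd⟩
        exact ⟨c + d, by simpa using hc.add hd⟩
      smul_mem' := by
        rintro z a ⟨c, hc⟩
        exact ⟨z • c, by simpa using hc.const_smul z⟩ }
  have hev : ∀ᶠ r : ℝ in 𝓝[<] 1, r ∈ Set.Ioo (0 : ℝ) 1 := Ioo_mem_nhdsLT zero_lt_one
  have hclosed : ∀ y, y ∈ closure (V : Set (Fock n (defT T))) → y ∈ V := by
    intro y hy
    change ∃ c, Tendsto (fun r : ℝ => charR T r y) (𝓝[<] 1) (𝓝 c)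
    refine cauchy_map_iff_exists_tendsto.1 ?_
    rw [Metric.cauchy_iff]
    refine ⟨inferInstance, fun ε hε => ?_⟩
    obtain ⟨z, ⟨c, hc⟩, hz⟩ := Metric.mem_closure_iff.1 hy (ε / 4) (by positivity)
    have hnear := hc (Metric.ball_mem_nhds c (show 0 < ε / 4 by positivity))
    refine ⟨Metric.ball c (ε / 2), ?_, fun a ha b hb => ?_⟩
    · rw [mem_map]
      filter_upwards [hnear, hev] with r hr hr01
      have e1 : dist (charR T r y) (charR T r z) < ε / 4 := by
        rw [dist_eq_norm, ← map_sub]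
        refine (norm_charR_le hT hr01.1.le hr01.2 _).trans_lt ?_
        rwa [← dist_eq_norm]
      have e2 : dist (charR T r z) c < ε / 4 := hr
      have := dist_triangle (charR T r y) (charR T r z) c
      change dist (charR T r y) c < ε / 2
      linarith
    · have e1 : dist a c < ε / 2 := ha
      have e2 : dist b c < ε / 2 := hb
      have := dist_triangle_right a b c
      linarith
  have hsum := lp.hasSum_single (p := 2) (by norm_num) x
  refine hclosed x (mem_closure_of_tendsto hsum (Eventually.of_forall fun S => ?_))
  exact V.sum_mem fun β _ => charR_single_tendsto hT β (x β)

open Classical in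
/-- The characteristic function `Θ_T = SOT-lim_{r → 1⁻} Θ_T(rR)`. The limit exists for every row
contraction (`charFun_tendsto`). -/
def charFun (T : Fin n → H →L[ℂ] H) : Fock n (defT T) →L[ℂ] Fock n (defTstar T) :=
  if h : ∃ Θ : Fock n (defT T) →L[ℂ] Fock n (defTstar T),
      ∀ x, Tendsto (fun r : ℝ => charR T r x) (𝓝[<] 1) (𝓝 (Θ x))
  then h.choose else 0

/-- For a row contraction the limit defining the characteristic function exists. -/
theorem charFun_tendsto {T : Fin n → H →L[ℂ] H} (hT : IsRowContraction T) (x : Fock n (defT T)) :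
    Tendsto (fun r : ℝ => charR T r x) (𝓝[<] 1) (𝓝 (charFun T x)) := by
  have h : ∃ Θ : Fock n (defT T) →L[ℂ] Fock n (defTstar T),
      ∀ x, Tendsto (fun r : ℝ => charR T r x) (𝓝[<] 1) (𝓝 (Θ x)) := by
    choose θ hθ using charR_tendsto hT
    have hev : ∀ᶠ r : ℝ in 𝓝[<] 1, r ∈ Set.Ioo (0 : ℝ) 1 := Ioo_mem_nhdsLT zero_lt_one
    refine ⟨LinearMap.mkContinuous
      { toFun := θ
        map_add' := fun a b => tendsto_nhds_unique (hθ (a + b))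
          (by simpa using (hθ a).add (hθ b))
        map_smul' := fun z a => tendsto_nhds_unique (hθ (z • a))
          (by simpa using (hθ a).const_smul z) } 1 (fun x => ?_), hθ⟩
    rw [one_mul]
    refine le_of_tendsto (hθ x).norm ?_
    filter_upwards [hev] with r hr
    exact norm_charR_le hT hr.1.le hr.2 x
  have e : charFun T = h.choose := by rw [charFun, dif_pos h]
  rw [e]
  exact h.choose_spec x

end Char

/-! ### Noncommutative varieties -/

section Variety

variable {n : ℕ}

/-- The WOT-closure of a set of operators. -/
def wotClosure {E : Type*} [NormedAddCommGroup E] [InnerProductSpace ℂ E]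
    (S : Set (E →L[ℂ] E)) : Set (E →L[ℂ] E) :=
  {X | (ContinuousLinearMapWOT.ofCLM X : E →WOT[ℂ] E) ∈
    closure ((ContinuousLinearMapWOT.ofCLM : (E →L[ℂ] E) → E →WOT[ℂ] E) '' S)}

/-- The noncommutative disc algebra: the norm closed algebra generated by `I, L_1, …, L_n`. -/
def discAlgebra (n : ℕ) : Subalgebra ℂ (Gam n →L[ℂ] Gam n) :=
  (Algebra.adjoin ℂ (Set.range fun j : Fin n => leftCreation ℂ j)).topologicalClosure

/-- The noncommutative analytic Toeplitz algebra: the WOT-closure of the disc algebra. -/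
def toeplitzAlgebra (n : ℕ) : Set (Gam n →L[ℂ] Gam n) := wotClosure (discAlgebra n)

/-- `I` is a WOT-closed two-sided ideal of the noncommutative analytic Toeplitz algebra. -/
def IsWOTClosedIdeal (I : Submodule ℂ (Gam n →L[ℂ] Gam n)) : Prop :=
  (I : Set (Gam n →L[ℂ] Gam n)) ⊆ toeplitzAlgebra n ∧
  (∀ X ∈ toeplitzAlgebra n, ∀ Y ∈ I, X * Y ∈ I ∧ Y * X ∈ I) ∧
  wotClosure (I : Set (Gam n →L[ℂ] Gam n)) = I

/-- The WOT-closed two-sided ideal `J` generated by the polynomials `p(L_1, …, L_n)`, `p ∈ P`. -/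
def genIdeal (P : Set (FreeAlgebra ℂ (Fin n))) : Submodule ℂ (Gam n →L[ℂ] Gam n) :=
  sInf {I | IsWOTClosedIdeal I ∧
    ∀ p ∈ P, FreeAlgebra.lift ℂ (fun j : Fin n => leftCreation ℂ j) p ∈ I}

/-- `M_J`, the closed span of the vectors `φ ψ`, `φ ∈ J`, `ψ ∈ Γ`. -/
def MJ (P : Set (FreeAlgebra ℂ (Fin n))) : Submodule ℂ (Gam n) :=
  (Submodule.span ℂ {x | ∃ φ ∈ genIdeal P, ∃ ψ : Gam n, x = φ ψ}).topologicalClosure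

/-- `N_J = Γ ⊖ M_J`. -/
def NJ (P : Set (FreeAlgebra ℂ (Fin n))) : Submodule ℂ (Gam n) := (MJ P)ᗮ

variable {E F G K : Type*} [NormedAddCommGroup E] [InnerProductSpace ℂ E]
  [NormedAddCommGroup F] [InnerProductSpace ℂ F] [NormedAddCommGroup G] [InnerProductSpace ℂ G]
  [NormedAddCommGroup K] [InnerProductSpace ℂ K]

/-- The Hilbert space tensor product `N_J ⊗ E`, as a closed subspace of `Γ ⊗ E`. -/
def NTens (P : Set (FreeAlgebra ℂ (Fin n))) (E : Type*) [NormedAddCommGroup E]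
    [InnerProductSpace ℂ E] : Submodule ℂ (Fock n E) :=
  (Submodule.span ℂ {x | ∃ f ∈ NJ P, ∃ η : E, x = tens f η}).topologicalClosure

instance (P : Set (FreeAlgebra ℂ (Fin n))) [CompleteSpace E] : CompleteSpace (NTens P E) :=
  inferInstanceAs (CompleteSpace
    ((Submodule.span ℂ {x | ∃ f ∈ NJ P, ∃ η : E, x = tens f η}).topologicalClosure))

theorem tens_mem {P : Set (FreeAlgebra ℂ (Fin n))} {f : Gam n} (hf : f ∈ NJ P) (η : E) :
    tens f η ∈ NTens P E :=
  Submodule.le_topologicalClosure _ (Submodule.subset_span ⟨f, hf, η, rfl⟩)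

theorem ampl_tens (X : E →L[ℂ] F) (f : Gam n) (η : E) : ampl n X (tens f η) = tens f (X η) := by
  ext α
  simp

theorem ampl_mem (P : Set (FreeAlgebra ℂ (Fin n))) (X : E →L[ℂ] F) {x : Fock n E}
    (hx : x ∈ NTens P E) : ampl n X x ∈ NTens P F := by
  have h : (Submodule.span ℂ {x | ∃ f ∈ NJ P, ∃ η : E, x = tens f η}) ≤
      (NTens P F).comap (ampl n X : Fock n E →ₗ[ℂ] Fock n F) := by
    rw [Submodule.span_le]
    rintro _ ⟨f, hf, η, rfl⟩
    change ampl n X (tens f η) ∈ NTens P F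
    rw [ampl_tens]
    exact tens_mem hf _
  have hc : IsClosed ((NTens P F).comap (ampl n X : Fock n E →ₗ[ℂ] Fock n F) : Set (Fock n E)) :=
    (Submodule.isClosed_topologicalClosure _).preimage (ampl n X).continuous
  exact Submodule.topologicalClosure_minimal _ h hc hx

/-- The operator `I_{N_J} ⊗ X : N_J ⊗ E → N_J ⊗ F`. -/
def NAmpl (P : Set (FreeAlgebra ℂ (Fin n))) (X : E →L[ℂ] F) : NTens P E →L[ℂ] NTens P F :=
  (ampl n X ∘L (NTens P E).subtypeL).codRestrict (NTens P F) fun x => ampl_mem P X x.2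

/-- For `M : N_J ⊗ E → N_J ⊗ G`, the block diagonal operator
`diag (M, I_{N_J ⊗ K}) : N_J ⊗ (E ⊕ K) → N_J ⊗ (G ⊕ K)`. -/
def diagI (P : Set (FreeAlgebra ℂ (Fin n))) (K : Type*) [NormedAddCommGroup K]
    [InnerProductSpace ℂ K] (M : NTens P E →L[ℂ] NTens P G) :
    NTens P (WithLp 2 (E × K)) →L[ℂ] NTens P (WithLp 2 (G × K)) :=
  NAmpl P (inlL G K) ∘L M ∘L NAmpl P (WithLp.fstL 2 ℂ E K) +
    NAmpl P (inrL G K) ∘L NAmpl P (WithLp.sndL 2 ℂ E K)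

section Pure

variable (P : Set (FreeAlgebra ℂ (Fin n)))

/-- A contraction `M : N_J ⊗ E → N_J ⊗ F` is purely contractive (here `e_∅ ∈ N_J`) if
`‖P_{e_∅ ⊗ F} M (e_∅ ⊗ η)‖ < ‖η‖` for `η ≠ 0`. The projection onto `e_∅ ⊗ F` maps `x` to
`e_∅ ⊗ x_∅`, a vector of norm `‖x_∅‖`. -/
def IsPurelyContractive (he : vacuum n ∈ NJ P) (M : NTens P E →L[ℂ] NTens P F) : Prop :=
  ‖M‖ ≤ 1 ∧ ∀ η : E, η ≠ 0 →
    ‖tens (vacuum n) ((M ⟨tens (vacuum n) η, tens_mem he η⟩ : Fock n F) 1)‖ < ‖η‖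

/-- `M` and `M'` coincide: `(I ⊗ W_*) M = M' (I ⊗ W)` for some unitaries `W` and `W_*`. -/
def Coincides (M : NTens P E →L[ℂ] NTens P F) (M' : NTens P G →L[ℂ] NTens P K) : Prop :=
  ∃ (W : E ≃ₗᵢ[ℂ] G) (Ws : F ≃ₗᵢ[ℂ] K),
    NAmpl P (Ws : F →L[ℂ] K) ∘L M = M' ∘L NAmpl P (W : E →L[ℂ] G)

end Pure

/-- `T` is a `J`-constrained row contraction: `p(T_1, …, T_n) = 0` for all `p ∈ P`. -/
def IsConstrained {H : Type*} [NormedAddCommGroup H] [InnerProductSpace ℂ H]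
    (P : Set (FreeAlgebra ℂ (Fin n))) (T : Fin n → H →L[ℂ] H) : Prop :=
  IsRowContraction T ∧ ∀ p ∈ P, FreeAlgebra.lift ℂ T p = 0

/-- The constrained characteristic function
`Θ_{J,T} = P_{N_J ⊗ 𝒟_{T*}} Θ_T |_{N_J ⊗ 𝒟_T} : N_J ⊗ 𝒟_T → N_J ⊗ 𝒟_{T*}`. -/
def consChar {H : Type*} [NormedAddCommGroup H] [InnerProductSpace ℂ H] [CompleteSpace H]
    (P : Set (FreeAlgebra ℂ (Fin n))) (T : Fin n → H →L[ℂ] H) :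
    NTens P (defT T) →L[ℂ] NTens P (defTstar T) :=
  (NTens P (defTstar T)).orthogonalProjectionOnto ∘L charFun T ∘L (NTens P (defT T)).subtypeL

end Variety

/-! ### Upper triangular tuples and the product of characteristic functions -/

section Triangular

variable {n : ℕ} {H₁ H₂ F F' : Type*}
  [NormedAddCommGroup H₁] [InnerProductSpace ℂ H₁] [CompleteSpace H₁]
  [NormedAddCommGroup H₂] [InnerProductSpace ℂ H₂] [CompleteSpace H₂]
  [NormedAddCommGroup F] [InnerProductSpace ℂ F]
  [NormedAddCommGroup F'] [InnerProductSpace ℂ F']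

/-- The embedding of `H` as the `j`-th summand of `⊕ⁿ H`. -/
def copy (H : Type*) [NormedAddCommGroup H] [InnerProductSpace ℂ H] (j : Fin n) :
    H →L[ℂ] Copies n H :=
  (PiLp.continuousLinearEquiv 2 ℂ fun _ : Fin n => H).symm.toContinuousLinearMap ∘L
    ContinuousLinearMap.single ℂ (fun _ : Fin n => H) j

/-- The tuple on `H₁ ⊕ H₂` with entries `T_j = [A_j, X_j; 0, B_j]`, where
`X = (X_1, …, X_n) : ⊕ⁿ H₂ → H₁` is a row operator. -/
def upper (A : Fin n → H₁ →L[ℂ] H₁) (X : Copies n H₂ →L[ℂ] H₁) (B : Fin n → H₂ →L[ℂ] H₂)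
    (j : Fin n) : WithLp 2 (H₁ × H₂) →L[ℂ] WithLp 2 (H₁ × H₂) :=
  inlL H₁ H₂ ∘L (A j ∘L WithLp.fstL 2 ℂ H₁ H₂ + X ∘L copy H₂ j ∘L WithLp.sndL 2 ℂ H₁ H₂) +
    inrL H₁ H₂ ∘L B j ∘L WithLp.sndL 2 ℂ H₁ H₂

/-- `D_X` with values in the defect space. -/
def defectCod {H K : Type*} [NormedAddCommGroup H] [InnerProductSpace ℂ H] [CompleteSpace H]
    [NormedAddCommGroup K] [InnerProductSpace ℂ K] [CompleteSpace K] (X : H →L[ℂ] K) :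
    H →L[ℂ] defectSpace X :=
  (defect X).codRestrict (defectSpace X) fun x =>
    Submodule.le_topologicalClosure _ (LinearMap.mem_range_self _ x)

/-- `L = P_{𝒟_{A*}} w* |_{𝒟_B} : 𝒟_B → 𝒟_{A*}` for a unitary `w : 𝒟_{A*} ⊕ F → 𝒟_B ⊕ F'`. -/
def corner {A : Fin n → H₁ →L[ℂ] H₁} {B : Fin n → H₂ →L[ℂ] H₂}
    (w : WithLp 2 (defTstar A × F) ≃ₗᵢ[ℂ] WithLp 2 (defT B × F')) :
    defT B →L[ℂ] defTstar A :=
  WithLp.fstL 2 ℂ (defTstar A) F ∘L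
    (w.symm : WithLp 2 (defT B × F') →L[ℂ] WithLp 2 (defTstar A × F)) ∘L inlL (defT B) F'

/-- The tuple `T = [A, D_{A*} L D_B; 0, B]` on `H₁ ⊕ H₂`. -/
def upperOf (A : Fin n → H₁ →L[ℂ] H₁) (B : Fin n → H₂ →L[ℂ] H₂)
    (L : defT B →L[ℂ] defTstar A) :
    Fin n → WithLp 2 (H₁ × H₂) →L[ℂ] WithLp 2 (H₁ × H₂) :=
  upper A (defect (row A).adjoint ∘L (defTstar A).subtypeL ∘L L ∘L defectCod (row B)) B

/-- The product `diag (Θ_{J,B}, I) (I ⊗ w) diag (Θ_{J,A}, I)`, an operator from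
`N_J ⊗ (𝒟_A ⊕ F)` to `N_J ⊗ (𝒟_{B*} ⊕ F')`. -/
def prodChar (P : Set (FreeAlgebra ℂ (Fin n)))
    (A : Fin n → H₁ →L[ℂ] H₁) (B : Fin n → H₂ →L[ℂ] H₂)
    (w : WithLp 2 (defTstar A × F) ≃ₗᵢ[ℂ] WithLp 2 (defT B × F')) :
    NTens P (WithLp 2 (defT A × F)) →L[ℂ] NTens P (WithLp 2 (defTstar B × F')) :=
  diagI P F' (consChar P B) ∘L
    NAmpl P (w : WithLp 2 (defTstar A × F) →L[ℂ] WithLp 2 (defT B × F')) ∘L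
    diagI P F (consChar P A)

end Triangular

end RowContraction

end

/-! The argument is that of unitary colligations. For a contraction `X` the Julia operator with rows
`(X*, D_X)` and `(D_{X*}, -X)` is a unitary from `K ⊕ 𝒟_X` onto `N ⊕ 𝒟_{X*}`. When `X` is the row
operator of `T`, `Θ_T(rR)` is its transfer function: for an input `x` the state `h` solves `h = r R̃
(T̃* h + D_T x)`, and the output is `D_{T*} h - T x` (`charR_eq_of_state`).

Feed the output of the colligation of `A`, with `F` passed along unchanged, through `w` into the
colligation of `B`, with `F'` passed along unchanged. The cascade is again unitary
(`norm_sq_cascade`, `cascade_surjective`), its transfer function is the product of the two, and its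
state operator is exactly `T*`: the coupling `D_B L* D_{A*}` from the state of `A` to that of `B` is
the adjoint of the corner entry `D_{A*} L D_B` (`adjoint_row_upperOf`).

A unitary colligation is determined, up to unitaries on its input and output spaces, by its state
operator as soon as its feedthrough operator is strictly contractive on nonzero vectors
(`exists_unitary_of_colligation`). The feedthrough of the cascade is the vacuum-to-vacuum part of
the given product (`prodChar_vacuum`), so pure contractivity is precisely this condition. Hence the
cascade is the Julia operator of `T` up to unitaries `W` and `W_*`; these intertwine `Θ_T(rR)` with
the product for every `r < 1`, and the strong limit `r → 1` gives the statement on the full Fock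
space (`exists_charFun_upperOf`).

To descend to `N_J`, note that a characteristic function commutes with the left creation operators.
Each of its scalar slices therefore commutes with all of `J`, so it maps `M_J ⊗ E` into `M_J ⊗ G`
(`preservesMJ_of_leftCreation`). For operators with this property, compression to `N_J` is
multiplicative, so the factorization passes to the constrained functions with the same `W` and
`W_*`. -/

noncomputable section

namespace RowContraction

/-! ### Uniqueness of unitary colligations with a given state operator -/

section Colligation

variable {K N E G : Type*}
  [NormedAddCommGroup K] [InnerProductSpace ℂ K] [CompleteSpace K]
  [NormedAddCommGroup N] [InnerProductSpace ℂ N] [CompleteSpace N]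
  [NormedAddCommGroup E] [InnerProductSpace ℂ E] [CompleteSpace E]
  [NormedAddCommGroup G] [InnerProductSpace ℂ G] [CompleteSpace G]

/-- The assignment `S x ↦ S' x` is well defined and isometric between dense subspaces, so it
extends. Both unitaries of the theorem arise in this way. -/
theorem exists_isometryEquiv_of_norm_eq (S : N →L[ℂ] E) (S' : N →L[ℂ] G) (hS : DenseRange S)
    (hS' : DenseRange S') (h : ∀ x, ‖S' x‖ = ‖S x‖) : ∃ U : E ≃ₗᵢ[ℂ] G, ∀ x, U (S x) = S' x :=
  ⟨(LinearEquiv.refl ℂ N).extendOfIsometry (e₁ := (S : N →ₗ[ℂ] E)) (e₂ := (S' : N →ₗ[ℂ] G)) hS hS' h,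
    fun x => LinearEquiv.extendOfIsometry_eq (f := LinearEquiv.refl ℂ N)
      (e₁ := (S : N →ₗ[ℂ] E)) (e₂ := (S' : N →ₗ[ℂ] G)) hS hS' h x⟩

theorem denseRange_defectCod (X : N →L[ℂ] K) : DenseRange (defectCod X) := by
  intro y
  rw [closure_subtype]
  have hy : (y : N) ∈ closure ((defect X).range : Set N) := by
    have : (y : N) ∈ ((defect X).range.topologicalClosure : Set N) := y.2
    rwa [Submodule.topologicalClosure_coe] at this
  refine closure_mono ?_ hy
  rintro _ ⟨x, rfl⟩
  exact ⟨defectCod X x, ⟨x, rfl⟩, rfl⟩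

theorem denseRange_of_adjoint_injective (S : N →L[ℂ] E) (h : ∀ x, S.adjoint x = 0 → x = 0) :
    DenseRange S := by
  have h1 : S.rangeᗮ = ⊥ := by
    rw [eq_bot_iff]
    intro x hx
    refine h x (ext_inner_left ℂ fun y => ?_)
    rw [ContinuousLinearMap.adjoint_inner_right, inner_zero_right]
    exact (Submodule.mem_orthogonal _ _).1 hx _ ⟨y, rfl⟩
  have h2 := (Submodule.topologicalClosure_eq_top_iff (K := S.range)).2 h1
  intro y
  have : y ∈ S.range.topologicalClosure := h2 ▸ Submodule.mem_top
  rwa [← SetLike.mem_coe, Submodule.topologicalClosure_coe] at this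

/-- The kernel of the self-adjoint operator `D_X` is orthogonal to the closure of its range. -/
theorem defect_injective_on (X : N →L[ℂ] K) {y : N} (hy : y ∈ defectSpace X)
    (h : defect X y = 0) : y = 0 := by
  have h1 : defectSpace X ≤ (ℂ ∙ y)ᗮ := by
    refine Submodule.topologicalClosure_minimal _ ?_ (Submodule.isClosed_orthogonal _)
    rintro _ ⟨x, rfl⟩
    rw [Submodule.mem_orthogonal_singleton_iff_inner_right]
    change ⟪y, defect X x⟫_ℂ = 0
    rw [← ContinuousLinearMap.adjoint_inner_left, defect_adjoint, h, inner_zero_left]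
  have h2 := h1 hy
  rw [Submodule.mem_orthogonal_singleton_iff_inner_right] at h2
  exact inner_self_eq_zero.1 h2

/-- This follows from `X D_X = D_{X*} X` and continuity. -/
theorem apply_mem_defectSpace {X : N →L[ℂ] K} (hX : ‖X‖ ≤ 1) {y : N} (hy : y ∈ defectSpace X) :
    X y ∈ defectSpace X.adjoint := by
  have hc : IsClosed (((defectSpace X.adjoint).comap (X : N →ₗ[ℂ] K)) : Set N) :=
    (Submodule.isClosed_topologicalClosure _).preimage X.continuous
  have hle : defectSpace X ≤ (defectSpace X.adjoint).comap (X : N →ₗ[ℂ] K) := by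
    refine Submodule.topologicalClosure_minimal _ ?_ hc
    rintro _ ⟨z, rfl⟩
    have := congrArg (fun Z : N →L[ℂ] K => Z z) (comp_defect hX)
    change X (defect X z) ∈ defectSpace X.adjoint
    change X (defect X z) = defect X.adjoint (X z) at this
    rw [this]
    exact Submodule.le_topologicalClosure _ (LinearMap.mem_range_self _ _)
  exact hle hy

/-- A unitary colligation `[X*, b; c, d]` whose feedthrough operator `d` is strictly contractive on
nonzero vectors is unitarily equivalent to the Julia operator of `X`. -/
theorem exists_unitary_of_colligation {X : N →L[ℂ] K} (hX : ‖X‖ ≤ 1) (b : E →L[ℂ] N)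
    (c : K →L[ℂ] G) (d : E →L[ℂ] G)
    (hiso : ∀ h x, ‖X.adjoint h + b x‖ ^ 2 + ‖c h + d x‖ ^ 2 = ‖h‖ ^ 2 + ‖x‖ ^ 2)
    (hsurj : ∀ k g, ∃ h x, X.adjoint h + b x = k ∧ c h + d x = g)
    (hpure : ∀ x, x ≠ 0 → ‖d x‖ < ‖x‖) :
    ∃ (W : E ≃ₗᵢ[ℂ] defectSpace X) (Ws : G ≃ₗᵢ[ℂ] defectSpace X.adjoint),
      (∀ x, defect X (W x) = b x) ∧ (∀ h, (Ws (c h) : K) = defect X.adjoint h) ∧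
      ∀ x, (Ws (d x) : K) = - X (W x) := by
  have hX' : ‖X.adjoint‖ ≤ 1 := by simpa using hX
  let V₀ : WithLp 2 (K × E) →ₗᵢ[ℂ] WithLp 2 (N × G) :=
    { toFun := fun z => WithLp.toLp 2 (X.adjoint z.fst + b z.snd, c z.fst + d z.snd)
      map_add' := fun y z => by
        apply WithLp.ofLp_injective
        ext <;> simp <;> abel
      map_smul' := fun t z => by
        apply WithLp.ofLp_injective
        ext <;> simp
      norm_map' := fun z => by
        have h1 := WithLp.prod_norm_sq_eq_of_L2 z
        have h2 := WithLp.prod_norm_sq_eq_of_L2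
          (WithLp.toLp 2 (X.adjoint z.fst + b z.snd, c z.fst + d z.snd) : WithLp 2 (N × G))
        have h3 := hiso z.fst z.snd
        have h4 : ‖(WithLp.toLp 2 (X.adjoint z.fst + b z.snd, c z.fst + d z.snd) :
            WithLp 2 (N × G))‖ ^ 2 = ‖z‖ ^ 2 := by
          rw [h1, h2]; exact h3
        exact (pow_left_inj₀ (norm_nonneg _) (norm_nonneg _) two_ne_zero).1 h4 }
  have hV : Function.Surjective V₀ := fun z => by
    obtain ⟨h, x, h1, h2⟩ := hsurj z.fst z.snd
    refine ⟨WithLp.toLp 2 (h, x), WithLp.ofLp_injective 2 (Prod.ext h1 h2)⟩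
  let V := LinearIsometryEquiv.ofSurjective V₀ hV
  -- The inverse of a unitary is its adjoint, hence the transposed block matrix with adjoint
  -- entries. Its being isometric gives the relations that the original columns do not.
  have hVs : ∀ k g, V.symm (WithLp.toLp 2 (k, g)) =
      WithLp.toLp 2 (X k + c.adjoint g, b.adjoint k + d.adjoint g) := by
    intro k g
    refine ext_inner_left ℂ fun z => ?_
    rw [← V.inner_map_map, V.apply_symm_apply]
    change ⟪(WithLp.toLp 2 (X.adjoint z.fst + b z.snd, c z.fst + d z.snd) : WithLp 2 (N × G)),
      WithLp.toLp 2 (k, g)⟫_ℂ = _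
    rw [WithLp.prod_inner_apply, WithLp.prod_inner_apply]
    simp only [inner_add_left, inner_add_right, ContinuousLinearMap.adjoint_inner_left,
      ContinuousLinearMap.adjoint_inner_right, WithLp.ofLp_fst, WithLp.ofLp_snd]
    ring
  -- Isometry of the inverse on `(k, 0)`: `‖X k‖² + ‖b* k‖² = ‖k‖²`.
  have hb : ∀ k, ‖b.adjoint k‖ = ‖defectCod X k‖ := by
    intro k
    have h1 := V.symm.norm_map (WithLp.toLp 2 (k, (0 : G)))
    have h2 := congrArg (· ^ 2) h1
    simp only [hVs, WithLp.prod_norm_sq_eq_of_L2] at h2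
    have h3 := norm_sq_defect hX k
    have h4 : ‖defectCod X k‖ = ‖defect X k‖ := rfl
    rw [h4, ← pow_left_inj₀ (norm_nonneg _) (norm_nonneg _) two_ne_zero]
    simp at h2
    linarith
  have hc : ∀ h, ‖c h‖ = ‖defectCod X.adjoint h‖ := by
    intro h
    have h2 := hiso h 0
    have h3 := norm_sq_defect hX' h
    have h4 : ‖defectCod X.adjoint h‖ = ‖defect X.adjoint h‖ := rfl
    rw [h4, ← pow_left_inj₀ (norm_nonneg _) (norm_nonneg _) two_ne_zero]
    simp at h2
    linarith
  have hd : ∀ x, ‖x‖ ≤ ‖d x‖ → x = 0 := fun x hx => by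
    by_contra h
    exact (hpure x h).not_ge hx
  -- Purity enters here: if `b x = 0`, the isometry on `(0, x)` forces `‖d x‖ = ‖x‖`, so `x = 0`.
  have hbd : DenseRange b.adjoint := by
    refine denseRange_of_adjoint_injective _ fun x hx => hd x ?_
    rw [ContinuousLinearMap.adjoint_adjoint] at hx
    have h2 := hiso 0 x
    simp [hx] at h2
    exact h2.ge
  -- If `c* g = 0`, the inverse sends `(0, g)` to `(0, d* g)`. Hence `g = d (d* g)` with `‖d* g‖ =
  -- ‖g‖`, and purity at `d* g` gives `g = 0`.
  have hcd : DenseRange c := by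
    refine denseRange_of_adjoint_injective _ fun g hg => ?_
    have h1 := hVs 0 g
    rw [LinearIsometryEquiv.symm_apply_eq] at h1
    have h2 : (WithLp.toLp 2 ((0 : N), g) : WithLp 2 (N × G)) =
        V₀ (WithLp.toLp 2 (X 0 + c.adjoint g, b.adjoint 0 + d.adjoint g)) := h1
    have h3 := congrArg WithLp.snd h2
    have h5 : g = d (d.adjoint g) := by simpa [V₀, hg] using h3
    have h6 := V.symm.norm_map (WithLp.toLp 2 ((0 : N), g))
    have h7 := congrArg (· ^ 2) h6
    simp only [hVs, WithLp.prod_norm_sq_eq_of_L2] at h7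
    simp [hg] at h7
    have h8 := hd (d.adjoint g) (by rw [← h5, h7])
    rw [h5, h8, map_zero]
  obtain ⟨U, hU⟩ := exists_isometryEquiv_of_norm_eq (defectCod X) b.adjoint
    (denseRange_defectCod X) hbd hb
  obtain ⟨Ws, hWs⟩ := exists_isometryEquiv_of_norm_eq c (defectCod X.adjoint) hcd
    (denseRange_defectCod _) fun h => (hc h).symm
  -- This is the adjoint of the relation `U D_X = b*`; the input unitary is the inverse of `U`.
  have hW : ∀ x, defect X (U.symm x) = b x := by
    intro x
    refine ext_inner_left ℂ fun k => ?_
    rw [← ContinuousLinearMap.adjoint_inner_left, defect_adjoint,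
      ← ContinuousLinearMap.adjoint_inner_left, ← hU]
    change ⟪defectCod X k, U.symm x⟫_ℂ = _
    rw [← U.inner_map_map, U.apply_symm_apply]
  have hWsc : ∀ h, (Ws (c h) : K) = defect X.adjoint h := fun h => congrArg Subtype.val (hWs h)
  refine ⟨U.symm, Ws, hW, hWsc, fun x => ?_⟩
  -- Both terms lie in `𝒟_{X*}`, where `D_{X*}` is injective. It remains to pair with `D_{X*} h`,
  -- and the pairing is `⟪X* h, b x⟫ + ⟪c h, d x⟫`, which vanishes because the two columns of the
  -- isometry are orthogonal.
  have hmem : (Ws (d x) : K) + X (U.symm x) ∈ defectSpace X.adjoint :=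
    add_mem (Ws (d x)).2 (apply_mem_defectSpace hX (U.symm x).2)
  refine eq_neg_of_add_eq_zero_left (defect_injective_on _ hmem (ext_inner_left ℂ fun h => ?_))
  rw [inner_zero_right, map_add, inner_add_right]
  have h1 : ⟪h, defect X.adjoint (Ws (d x))⟫_ℂ = ⟪c h, d x⟫_ℂ := by
    rw [← ContinuousLinearMap.adjoint_inner_left, defect_adjoint, ← hWsc, ← Ws.inner_map_map]
    rfl
  have h2 : ⟪h, defect X.adjoint (X (U.symm x))⟫_ℂ = ⟪X.adjoint h, b x⟫_ℂ := by
    have := congrArg (fun Z : N →L[ℂ] K => Z (U.symm x)) (comp_defect hX)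
    change X (defect X (U.symm x)) = defect X.adjoint (X (U.symm x)) at this
    rw [← this, hW, ContinuousLinearMap.adjoint_inner_left]
  have h3 := V₀.inner_map_map (WithLp.toLp 2 (h, (0 : E))) (WithLp.toLp 2 ((0 : K), x))
  simp only [WithLp.prod_inner_apply, V₀] at h3
  simp at h3
  rw [h1, h2, add_comm]
  exact h3

end Colligation

/-! ### The Julia operator is unitary -/

section Julia

variable {N K : Type*}
  [NormedAddCommGroup K] [InnerProductSpace ℂ K] [CompleteSpace K]
  [NormedAddCommGroup N] [InnerProductSpace ℂ N] [CompleteSpace N]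

/-- The restriction `𝒟_X → 𝒟_{X*}` of a contraction `X`. -/
def feed {X : N →L[ℂ] K} (hX : ‖X‖ ≤ 1) : defectSpace X →L[ℂ] defectSpace X.adjoint :=
  (X ∘L (defectSpace X).subtypeL).codRestrict _ fun x => apply_mem_defectSpace hX x.2

theorem norm_sq_julia {X : N →L[ℂ] K} (hX : ‖X‖ ≤ 1) (h : K) (x : defectSpace X) :
    ‖X.adjoint h + defect X x‖ ^ 2 + ‖defectCod X.adjoint h - feed hX x‖ ^ 2 =
      ‖h‖ ^ 2 + ‖x‖ ^ 2 :=
  julia hX h x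

theorem julia_surjective {X : N →L[ℂ] K} (hX : ‖X‖ ≤ 1) (k : N) (y : defectSpace X.adjoint) :
    ∃ (h : K) (x : defectSpace X), X.adjoint h + defect X x = k ∧
      defectCod X.adjoint h - feed hX x = y := by
  have hX' : ‖X.adjoint‖ ≤ 1 := by simpa using hX
  have hm : X.adjoint y ∈ defectSpace X := by
    have := apply_mem_defectSpace hX' y.2
    rwa [ContinuousLinearMap.adjoint_adjoint] at this
  have e1 : ∀ z, X (defect X z) = defect X.adjoint (X z) := fun z =>
    congrArg (fun Z : N →L[ℂ] K => Z z) (comp_defect hX)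
  have e2 : ∀ z, X.adjoint (defect X.adjoint z) = defect X (X.adjoint z) := fun z => by
    have := congrArg (fun Z : K →L[ℂ] N => Z z) (comp_defect hX')
    rwa [ContinuousLinearMap.adjoint_adjoint] at this
  have e3 : ∀ z, defect X (defect X z) = z - X.adjoint (X z) := fun z =>
    congrArg (fun Z : N →L[ℂ] N => Z z) (defect_mul_self hX)
  have e4 : ∀ z, defect X.adjoint (defect X.adjoint z) = z - X (X.adjoint z) := fun z => by
    have := congrArg (fun Z : K →L[ℂ] K => Z z) (defect_mul_self hX')
    rwa [ContinuousLinearMap.adjoint_adjoint] at this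
  -- The preimage is the adjoint Julia operator, with rows `(X, D_{X*})` and `(D_X, -X*)`, applied
  -- to `(k, y)`.
  refine ⟨X k + defect X.adjoint y, defectCod X k - ⟨_, hm⟩, ?_, Subtype.ext ?_⟩
  · change X.adjoint (X k + defect X.adjoint y) + defect X (defect X k - X.adjoint y) = k
    rw [map_add, map_sub, e2, e3]
    abel
  · change defect X.adjoint (X k + defect X.adjoint y) - X (defect X k - X.adjoint y) = y
    rw [map_add, map_sub, e1, e4]
    abel

end Julia

/-! ### The characteristic function as a transfer function -/

section Transfer

variable {n : ℕ} {H K : Type*}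
  [NormedAddCommGroup H] [InnerProductSpace ℂ H] [CompleteSpace H]
  [NormedAddCommGroup K] [InnerProductSpace ℂ K] [CompleteSpace K]

/-- The state is produced by the resolvent in the definition of `charFullR`. Describing it by an
equation allows states to be combined and transformed without manipulating inverses. -/
theorem exists_state {T : Fin n → H →L[ℂ] H} (hT : IsRowContraction T) {r : ℝ} (h0 : 0 ≤ r)
    (h1 : r < 1) (x : Fock n (Copies n H)) :
    ∃ h : Fock n H, h = (r : ℂ) • rightRow n H
      (ampl n (row T).adjoint h + ampl n (defect (row T)) x) := by
  refine ⟨Ring.inverse (1 - (r : ℂ) • (rightRow n H ∘L ampl n (row T).adjoint))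
    ((r : ℂ) • rightRow n H (ampl n (defect (row T)) x)), ?_⟩
  rw [map_add, smul_add, ← sub_eq_iff_eq_add']
  exact congrArg (fun Z => Z ((r : ℂ) • rightRow n H (ampl n (defect (row T)) x)))
    (Ring.mul_inverse_cancel _ (isUnit_resolvent hT h0 h1))

theorem charFullR_eq_of_state {T : Fin n → H →L[ℂ] H} (hT : IsRowContraction T) {r : ℝ}
    (h0 : 0 ≤ r) (h1 : r < 1) {x : Fock n (Copies n H)} {h : Fock n H}
    (hh : h = (r : ℂ) • rightRow n H (ampl n (row T).adjoint h + ampl n (defect (row T)) x)) :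
    charFullR T r x = ampl n (defect (row T).adjoint) h - ampl n (row T) x := by
  have e1 : (r : ℂ) • rightRow n H (ampl n (defect (row T)) x) =
      (1 - (r : ℂ) • (rightRow n H ∘L ampl n (row T).adjoint)) h := by
    change _ = h - (r : ℂ) • rightRow n H (ampl n (row T).adjoint h)
    nth_rewrite 1 [hh]
    rw [map_add, smul_add]
    abel
  have e2 : Ring.inverse (1 - (r : ℂ) • (rightRow n H ∘L ampl n (row T).adjoint))
      ((r : ℂ) • rightRow n H (ampl n (defect (row T)) x)) = h := by
    rw [e1]
    exact congrArg (fun Z => Z h) (Ring.inverse_mul_cancel _ (isUnit_resolvent hT h0 h1))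
  change - ampl n (row T) x + ampl n (defect (row T).adjoint) (Ring.inverse
    (1 - (r : ℂ) • (rightRow n H ∘L ampl n (row T).adjoint))
      ((r : ℂ) • rightRow n H (ampl n (defect (row T)) x))) = _
  rw [e2]
  abel

theorem coe_charR {T : Fin n → H →L[ℂ] H} (hT : IsRowContraction T) (r : ℝ)
    (x : Fock n (defT T)) (α : FreeMonoid (Fin n)) :
    (charR T r x α : H) = charFullR T r (ampl n (defT T).subtypeL x) α :=
  congrArg Subtype.val ((defTstar T).orthogonalProjectionOnto_mem_subspace_eq_self
    ⟨_, charFullR_mem hT r x α⟩)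

/-- The output is obtained by applying the second row of the Julia operator coordinate by
coordinate. Any solution of the state equation will do, since invertibility of `1 - r R̃ T̃*` makes
it unique. -/
theorem charR_eq_of_state {T : Fin n → H →L[ℂ] H} (hT : ‖row T‖ ≤ 1) {r : ℝ}
    (h0 : 0 ≤ r) (h1 : r < 1) {x : Fock n (defT T)} {h : Fock n H}
    (hh : h = (r : ℂ) • rightRow n H
      (ampl n (row T).adjoint h + ampl n (defect (row T)) (ampl n (defT T).subtypeL x)))
    (α : FreeMonoid (Fin n)) :
    charR T r x α = defectCod (row T).adjoint (h α) - feed hT (x α) := by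
  refine Subtype.ext ?_
  rw [coe_charR hT, charFullR_eq_of_state hT h0 h1 hh]
  rfl

theorem shift_ampl {E F : Type*} [NormedAddCommGroup E] [InnerProductSpace ℂ E]
    [NormedAddCommGroup F] [InnerProductSpace ℂ F] {s : FreeMonoid (Fin n) → FreeMonoid (Fin n)}
    (hs : Function.Injective s) (Y : E →L[ℂ] F) (f : Fock n E) :
    shift hs (ampl n Y f) = ampl n Y (shift hs f) := by
  refine lp.ext (funext fun α => ?_)
  rw [ampl_apply]
  by_cases h : ∃ β, s β = α
  · obtain ⟨β, rfl⟩ := h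
    rw [shift_apply, shift_apply, ampl_apply]
  · rw [shift_apply_of_notMem hs _ _ h, shift_apply_of_notMem hs _ _ h, map_zero]

theorem rightCreation_ampl (Y : H →L[ℂ] K) (j : Fin n) (f : Fock n H) :
    rightCreation K j (ampl n Y f) = ampl n Y (rightCreation H j f) :=
  shift_ampl (mul_left_injective (FreeMonoid.of j)) Y f

theorem rightRow_eq_sum (f : Fock n (Copies n H)) : rightRow n H f =
    ∑ j, rightCreation H j (ampl n (PiLp.proj 2 (fun _ : Fin n => H) j) f) := by
  simp [rightRow]

/-- The empty word does not end in a generator. States therefore have no vacuum component, and the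
vacuum coefficient of the output sees only the feedthrough. -/
theorem rightRow_apply_one (f : Fock n (Copies n H)) : rightRow n H f 1 = 0 := by
  have h : ∀ (j : Fin n) (g : Fock n H), rightCreation H j g 1 = 0 := fun j g => by
    refine shift_apply_of_notMem (mul_left_injective (FreeMonoid.of j)) g 1 ?_
    rintro ⟨β, hβ⟩
    have := congrArg FreeMonoid.length hβ
    simp [FreeMonoid.length_mul] at this
  rw [rightRow_eq_sum, lp.coeFn_sum, Finset.sum_apply]
  exact Finset.sum_eq_zero fun j _ => h j _

/-- The direct sum of `n` copies of an operator. -/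
def mapCopies (n : ℕ) (Y : H →L[ℂ] K) : Copies n H →L[ℂ] Copies n K :=
  ∑ j, copy K j ∘L Y ∘L PiLp.proj 2 (fun _ : Fin n => H) j

theorem copy_apply (j i : Fin n) (x : H) : copy H j x i = if i = j then x else 0 := by
  simp [copy]

@[simp] theorem mapCopies_apply (Y : H →L[ℂ] K) (k : Copies n H) (j : Fin n) :
    mapCopies n Y k j = Y (k j) := by
  simp [mapCopies, copy_apply]

theorem rightRow_ampl_mapCopies (Y : H →L[ℂ] K) (f : Fock n (Copies n H)) :
    rightRow n K (ampl n (mapCopies n Y) f) = ampl n Y (rightRow n H f) := by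
  rw [rightRow_eq_sum, rightRow_eq_sum, map_sum]
  refine Finset.sum_congr rfl fun j _ => ?_
  rw [← rightCreation_ampl]
  congr 1
  ext α
  exact mapCopies_apply Y (f α) j

theorem row_apply (T : Fin n → H →L[ℂ] H) (k : Copies n H) : row T k = ∑ j, T j (k j) := by
  simp [row]

end Transfer

/-! ### Coordinates on two-fold Hilbert sums -/

section WithLpProd

variable {H₁ H₂ : Type*} [NormedAddCommGroup H₁] [InnerProductSpace ℂ H₁]
  [NormedAddCommGroup H₂] [InnerProductSpace ℂ H₂]

@[simp] theorem inlL_fst (x : H₁) : (inlL H₁ H₂ x).fst = x := rfl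
@[simp] theorem inlL_snd (x : H₁) : (inlL H₁ H₂ x).snd = 0 := rfl
@[simp] theorem inrL_fst (x : H₂) : (inrL H₁ H₂ x).fst = 0 := rfl
@[simp] theorem inrL_snd (x : H₂) : (inrL H₁ H₂ x).snd = x := rfl

theorem withLp_prod_ext {x y : WithLp 2 (H₁ × H₂)} (h₁ : x.fst = y.fst) (h₂ : x.snd = y.snd) :
    x = y :=
  WithLp.ofLp_injective 2 (Prod.ext h₁ h₂)

theorem norm_sq_toLp (x : H₁) (y : H₂) :
    ‖(WithLp.toLp 2 (x, y) : WithLp 2 (H₁ × H₂))‖ ^ 2 = ‖x‖ ^ 2 + ‖y‖ ^ 2 :=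
  WithLp.prod_norm_sq_eq_of_L2 _

end WithLpProd

/-! ### The cascade of two Julia operators -/

section Cascade

variable {n : ℕ} {H₁ H₂ F F' : Type*}
  [NormedAddCommGroup H₁] [InnerProductSpace ℂ H₁] [CompleteSpace H₁]
  [NormedAddCommGroup H₂] [InnerProductSpace ℂ H₂] [CompleteSpace H₂]
  [NormedAddCommGroup F] [InnerProductSpace ℂ F] [CompleteSpace F]
  [NormedAddCommGroup F'] [InnerProductSpace ℂ F'] [CompleteSpace F']

theorem norm_sq_copies_prod (k : Copies n (WithLp 2 (H₁ × H₂))) :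
    ‖k‖ ^ 2 = ‖mapCopies n (WithLp.fstL 2 ℂ H₁ H₂) k‖ ^ 2 +
      ‖mapCopies n (WithLp.sndL 2 ℂ H₁ H₂) k‖ ^ 2 := by
  rw [PiLp.norm_sq_eq_of_L2, PiLp.norm_sq_eq_of_L2, PiLp.norm_sq_eq_of_L2,
    ← Finset.sum_add_distrib]
  refine Finset.sum_congr rfl fun j _ => ?_
  rw [WithLp.prod_norm_sq_eq_of_L2, mapCopies_apply, mapCopies_apply]
  rfl

theorem sum_copy (k : Copies n H₁) : ∑ j, copy H₁ j (k j) = k := by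
  ext i
  simp [copy_apply]

theorem adjoint_row_upper (A : Fin n → H₁ →L[ℂ] H₁) (X : Copies n H₂ →L[ℂ] H₁)
    (B : Fin n → H₂ →L[ℂ] H₂) (h : WithLp 2 (H₁ × H₂)) :
    (row (upper A X B)).adjoint h =
      mapCopies n (inlL H₁ H₂) ((row A).adjoint h.fst) +
        mapCopies n (inrL H₁ H₂) ((row B).adjoint h.snd + X.adjoint h.fst) := by
  refine ext_inner_left ℂ fun k => ?_
  have e1 : row (upper A X B) k =
      inlL H₁ H₂ (row A (mapCopies n (WithLp.fstL 2 ℂ H₁ H₂) k) +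
        X (mapCopies n (WithLp.sndL 2 ℂ H₁ H₂) k)) +
      inrL H₁ H₂ (row B (mapCopies n (WithLp.sndL 2 ℂ H₁ H₂) k)) := by
    have e2 : X (mapCopies n (WithLp.sndL 2 ℂ H₁ H₂) k) = ∑ j, X (copy H₂ j (k j).snd) := by
      rw [← map_sum, ← sum_copy (mapCopies n (WithLp.sndL 2 ℂ H₁ H₂) k)]
      simp
    rw [row_apply, row_apply, row_apply, e2, ← Finset.sum_add_distrib, map_sum, map_sum,
      ← Finset.sum_add_distrib]
    refine Finset.sum_congr rfl fun j _ => ?_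
    simp [upper]
  have e3 : ∀ u : Copies n H₁, ⟪k, mapCopies n (inlL H₁ H₂) u⟫_ℂ =
      ⟪mapCopies n (WithLp.fstL 2 ℂ H₁ H₂) k, u⟫_ℂ := fun u => by
    rw [PiLp.inner_apply, PiLp.inner_apply]
    refine Finset.sum_congr rfl fun j _ => ?_
    rw [mapCopies_apply, mapCopies_apply, WithLp.prod_inner_apply]
    change ⟪(k j).fst, u j⟫_ℂ + ⟪(k j).snd, (0 : H₂)⟫_ℂ = _
    rw [inner_zero_right, add_zero]
    rfl
  have e4 : ∀ u : Copies n H₂, ⟪k, mapCopies n (inrL H₁ H₂) u⟫_ℂ =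
      ⟪mapCopies n (WithLp.sndL 2 ℂ H₁ H₂) k, u⟫_ℂ := fun u => by
    rw [PiLp.inner_apply, PiLp.inner_apply]
    refine Finset.sum_congr rfl fun j _ => ?_
    rw [mapCopies_apply, mapCopies_apply, WithLp.prod_inner_apply]
    change ⟪(k j).fst, (0 : H₁)⟫_ℂ + ⟪(k j).snd, u j⟫_ℂ = _
    rw [inner_zero_right, zero_add]
    rfl
  rw [ContinuousLinearMap.adjoint_inner_right, e1, inner_add_right, e3, e4, inner_add_right,
    ContinuousLinearMap.adjoint_inner_right, ContinuousLinearMap.adjoint_inner_right,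
    ContinuousLinearMap.adjoint_inner_right, WithLp.prod_inner_apply]
  change ⟪row A (mapCopies n (WithLp.fstL 2 ℂ H₁ H₂) k) +
      X (mapCopies n (WithLp.sndL 2 ℂ H₁ H₂) k) + 0, h.fst⟫_ℂ +
    ⟪0 + row B (mapCopies n (WithLp.sndL 2 ℂ H₁ H₂) k), h.snd⟫_ℂ = _
  rw [add_zero, zero_add, inner_add_left]
  ring

/-- The operator `diag (-X, I) : 𝒟_X ⊕ F → 𝒟_{X*} ⊕ F`. -/
def diagFeed {N K : Type*} [NormedAddCommGroup K] [InnerProductSpace ℂ K] [CompleteSpace K]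
    [NormedAddCommGroup N] [InnerProductSpace ℂ N] [CompleteSpace N] {X : N →L[ℂ] K}
    (hX : ‖X‖ ≤ 1) (F : Type*) [NormedAddCommGroup F] [InnerProductSpace ℂ F] :
    WithLp 2 (defectSpace X × F) →L[ℂ] WithLp 2 (defectSpace X.adjoint × F) :=
  inrL _ F ∘L WithLp.sndL 2 ℂ _ F - inlL _ F ∘L feed hX ∘L WithLp.fstL 2 ℂ _ F

theorem diagFeed_fst {N K : Type*} [NormedAddCommGroup K] [InnerProductSpace ℂ K]
    [CompleteSpace K] [NormedAddCommGroup N] [InnerProductSpace ℂ N] [CompleteSpace N]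
    {X : N →L[ℂ] K} (hX : ‖X‖ ≤ 1) (z : WithLp 2 (defectSpace X × F)) :
    (diagFeed hX F z).fst = - feed hX z.fst := by
  change 0 - feed hX z.fst = _
  rw [zero_sub]

theorem diagFeed_snd {N K : Type*} [NormedAddCommGroup K] [InnerProductSpace ℂ K]
    [CompleteSpace K] [NormedAddCommGroup N] [InnerProductSpace ℂ N] [CompleteSpace N]
    {X : N →L[ℂ] K} (hX : ‖X‖ ≤ 1) (z : WithLp 2 (defectSpace X × F)) :
    (diagFeed hX F z).snd = z.snd := by
  change z.snd - 0 = _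
  rw [sub_zero]

variable {A : Fin n → H₁ →L[ℂ] H₁} {B : Fin n → H₂ →L[ℂ] H₂}
  (hA : ‖row A‖ ≤ 1) (hB : ‖row B‖ ≤ 1)
  (w : WithLp 2 (defTstar A × F) ≃ₗᵢ[ℂ] WithLp 2 (defT B × F'))

/-- The contribution of the state `h₁` to the input of the second factor of the cascade. -/
def linkState : WithLp 2 (H₁ × H₂) →L[ℂ] WithLp 2 (defT B × F') :=
  (w : WithLp 2 (defTstar A × F) →L[ℂ] WithLp 2 (defT B × F')) ∘L inlL (defTstar A) F ∘L
    defectCod (row A).adjoint ∘L WithLp.fstL 2 ℂ H₁ H₂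

/-- The contribution of the input to the input of the second factor of the cascade. -/
def linkInput : WithLp 2 (defT A × F) →L[ℂ] WithLp 2 (defT B × F') :=
  (w : WithLp 2 (defTstar A × F) →L[ℂ] WithLp 2 (defT B × F')) ∘L diagFeed hA F

/-- The input operator of the cascade of two Julia operators. -/
def cascadeInput : WithLp 2 (defT A × F) →L[ℂ] Copies n (WithLp 2 (H₁ × H₂)) :=
  mapCopies n (inlL H₁ H₂) ∘L defect (row A) ∘L (defT A).subtypeL ∘L WithLp.fstL 2 ℂ (defT A) F +
    mapCopies n (inrL H₁ H₂) ∘L defect (row B) ∘L (defT B).subtypeL ∘L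
      WithLp.fstL 2 ℂ (defT B) F' ∘L linkInput hA w

/-- The output operator of the cascade of two Julia operators. -/
def cascadeOutput : WithLp 2 (H₁ × H₂) →L[ℂ] WithLp 2 (defTstar B × F') :=
  inlL (defTstar B) F' ∘L defectCod (row B).adjoint ∘L WithLp.sndL 2 ℂ H₁ H₂ +
    diagFeed hB F' ∘L linkState w

/-- The feedthrough operator of the cascade of two Julia operators. -/
def cascadeFeed : WithLp 2 (defT A × F) →L[ℂ] WithLp 2 (defTstar B × F') :=
  diagFeed hB F' ∘L linkInput hA w

/-- The adjoint of `D_{A*} L D_B` is `D_B L* D_{A*}`, and `L*` is the compression of `w` from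
`𝒟_{A*}` to `𝒟_B`. This is the reason for the form of the corner of `T`: its adjoint row is the
state operator of the cascade. -/
theorem adjoint_row_upperOf (h : WithLp 2 (H₁ × H₂)) :
    (row (upperOf A B (corner w))).adjoint h =
      mapCopies n (inlL H₁ H₂) ((row A).adjoint h.fst) + mapCopies n (inrL H₁ H₂)
        ((row B).adjoint h.snd + defect (row B) (linkState w h).fst) := by
  rw [upperOf, adjoint_row_upper]
  congr 3
  refine ext_inner_left ℂ fun k => ?_
  rw [ContinuousLinearMap.adjoint_inner_right]
  change ⟪defect (row A).adjoint (corner w (defectCod (row B) k)), h.fst⟫_ℂ = _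
  rw [← ContinuousLinearMap.adjoint_inner_right, defect_adjoint]
  change ⟪corner w (defectCod (row B) k), defectCod (row A).adjoint h.fst⟫_ℂ = _
  have e1 : ⟪corner w (defectCod (row B) k), defectCod (row A).adjoint h.fst⟫_ℂ =
      ⟪w.symm (inlL (defT B) F' (defectCod (row B) k)),
        inlL (defTstar A) F (defectCod (row A).adjoint h.fst)⟫_ℂ := by
    rw [WithLp.prod_inner_apply]
    change _ = _ + ⟪_, (0 : F)⟫_ℂ
    rw [inner_zero_right, add_zero]
    rfl
  rw [e1, ← w.inner_map_map, w.apply_symm_apply]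
  change ⟪inlL (defT B) F' (defectCod (row B) k), linkState w h⟫_ℂ = _
  rw [WithLp.prod_inner_apply, ← ContinuousLinearMap.adjoint_inner_left, defect_adjoint]
  change _ + ⟪(0 : F'), _⟫_ℂ = _
  rw [inner_zero_left, add_zero]
  rfl

/-- With `link_eq` and `cascade_output_eq`, this identifies the block operator with the wiring: each
component of the new state comes from its own Julia operator, and the second one receives its input
through `w`. -/
theorem cascade_eq (h : WithLp 2 (H₁ × H₂)) (z : WithLp 2 (defT A × F)) :
    (row (upperOf A B (corner w))).adjoint h + cascadeInput (B := B) hA w z =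
      mapCopies n (inlL H₁ H₂) ((row A).adjoint h.fst + defect (row A) z.fst) +
        mapCopies n (inrL H₁ H₂) ((row B).adjoint h.snd +
          defect (row B) (linkState w h + linkInput hA w z).fst) := by
  have e : (linkState w h + linkInput hA w z).fst =
    (linkState w h).fst + (linkInput hA w z).fst := rfl
  rw [adjoint_row_upperOf, e, Submodule.coe_add, map_add (defect (row B))]
  simp only [map_add]
  change _ + _ + (mapCopies n (inlL H₁ H₂) (defect (row A) z.fst) + mapCopies n (inrL H₁ H₂)
    (defect (row B) (linkInput hA w z).fst)) = _
  abel

theorem link_eq (h : WithLp 2 (H₁ × H₂)) (z : WithLp 2 (defT A × F)) :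
    linkState w h + linkInput hA w z =
      w (WithLp.toLp 2 (defectCod (row A).adjoint h.fst - feed hA z.fst, z.snd)) := by
  have e : (WithLp.toLp 2 (defectCod (row A).adjoint h.fst - feed hA z.fst, z.snd) :
      WithLp 2 (defTstar A × F)) =
      inlL _ F (defectCod (row A).adjoint h.fst) + diagFeed hA F z := by
    refine withLp_prod_ext ?_ ?_
    · rw [WithLp.add_fst, diagFeed_fst, ← sub_eq_add_neg]
      rfl
    · rw [WithLp.add_snd, diagFeed_snd, inlL_snd, zero_add]
      rfl
  rw [e, map_add]
  rfl

theorem cascade_output_eq (h : WithLp 2 (H₁ × H₂)) (z : WithLp 2 (defT A × F)) :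
    cascadeOutput hB w h + cascadeFeed hA hB w z =
      WithLp.toLp 2 (defectCod (row B).adjoint h.snd -
        feed hB (linkState w h + linkInput hA w z).fst,
          (linkState w h + linkInput hA w z).snd) := by
  have e : cascadeOutput hB w h + cascadeFeed hA hB w z =
      inlL (defTstar B) F' (defectCod (row B).adjoint h.snd) +
        diagFeed hB F' (linkState w h + linkInput hA w z) := by
    rw [map_add, ← add_assoc]
    rfl
  rw [e]
  refine withLp_prod_ext ?_ ?_
  · rw [WithLp.add_fst, diagFeed_fst, ← sub_eq_add_neg]
    rfl
  · rw [WithLp.add_snd, diagFeed_snd, inlL_snd, zero_add]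
    rfl

/-- The norm identities of the two Julia operators add up; the intermediate signal `v` cancels
because `w` is isometric. -/
theorem norm_sq_cascade (h : WithLp 2 (H₁ × H₂)) (z : WithLp 2 (defT A × F)) :
    ‖(row (upperOf A B (corner w))).adjoint h + cascadeInput (B := B) hA w z‖ ^ 2 +
      ‖cascadeOutput hB w h + cascadeFeed hA hB w z‖ ^ 2 = ‖h‖ ^ 2 + ‖z‖ ^ 2 := by
  set v := linkState w h + linkInput hA w z with hv
  have h1 : ‖v‖ ^ 2 = ‖defectCod (row A).adjoint h.fst - feed hA z.fst‖ ^ 2 + ‖z.snd‖ ^ 2 := by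
    rw [hv, link_eq, w.norm_map, norm_sq_toLp]
  have h2 := norm_sq_julia hA h.fst z.fst
  have h3 := norm_sq_julia hB h.snd v.fst
  have h4 : ‖v‖ ^ 2 = ‖v.fst‖ ^ 2 + ‖v.snd‖ ^ 2 := WithLp.prod_norm_sq_eq_of_L2 v
  have hl : ∀ k₁ : Copies n H₁, ∀ k₂ : Copies n H₂,
      ‖mapCopies n (inlL H₁ H₂) k₁ + mapCopies n (inrL H₁ H₂) k₂‖ ^ 2 =
        ‖k₁‖ ^ 2 + ‖k₂‖ ^ 2 := fun k₁ k₂ => by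
    rw [norm_sq_copies_prod]
    congr 4 <;> ext j <;> simp
  rw [cascade_eq, cascade_output_eq, hl, norm_sq_toLp, WithLp.prod_norm_sq_eq_of_L2 h,
    WithLp.prod_norm_sq_eq_of_L2 z, ← hv]
  linarith

theorem cascade_surjective (k : Copies n (WithLp 2 (H₁ × H₂)))
    (g : WithLp 2 (defTstar B × F')) :
    ∃ (h : WithLp 2 (H₁ × H₂)) (z : WithLp 2 (defT A × F)),
      (row (upperOf A B (corner w))).adjoint h + cascadeInput (B := B) hA w z = k ∧
        cascadeOutput hB w h + cascadeFeed hA hB w z = g := by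
  -- The cascade is run backwards: invert the Julia operator of `B`, pull the signal back through
  -- `w`, then invert the Julia operator of `A`.
  obtain ⟨h₂, x₂, h3, h4⟩ := julia_surjective hB (mapCopies n (WithLp.sndL 2 ℂ H₁ H₂) k) g.fst
  obtain ⟨h₁, x₁, h1, h2⟩ := julia_surjective hA (mapCopies n (WithLp.fstL 2 ℂ H₁ H₂) k)
    (w.symm (WithLp.toLp 2 (x₂, g.snd))).fst
  set h : WithLp 2 (H₁ × H₂) := WithLp.toLp 2 (h₁, h₂) with hh
  set z : WithLp 2 (defT A × F) :=
    WithLp.toLp 2 (x₁, (w.symm (WithLp.toLp 2 (x₂, g.snd))).snd) with hz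
  have e : linkState w h + linkInput hA w z = WithLp.toLp 2 (x₂, g.snd) := by
    rw [link_eq, ← LinearIsometryEquiv.eq_symm_apply]
    exact withLp_prod_ext h2 rfl
  refine ⟨h, z, ?_, ?_⟩
  · rw [cascade_eq, e]
    change mapCopies n (inlL H₁ H₂) ((row A).adjoint h₁ + defect (row A) x₁) +
      mapCopies n (inrL H₁ H₂) ((row B).adjoint h₂ + defect (row B) x₂) = k
    rw [h1, h3]
    ext j
    refine withLp_prod_ext ?_ ?_ <;> simp
  · rw [cascade_output_eq, e]
    exact withLp_prod_ext h4 rfl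

end Cascade

/-! ### Strong limits of products with identity blocks -/

section Product

variable {n : ℕ} {E F G K : Type*} [NormedAddCommGroup E] [InnerProductSpace ℂ E]
  [NormedAddCommGroup F] [InnerProductSpace ℂ F] [NormedAddCommGroup G] [InnerProductSpace ℂ G]
  [NormedAddCommGroup K] [InnerProductSpace ℂ K]

/-- For `M : Γ ⊗ E → Γ ⊗ G`, the block diagonal operator
`diag (M, I) : Γ ⊗ (E ⊕ K) → Γ ⊗ (G ⊕ K)`. -/
def diagFock (K : Type*) [NormedAddCommGroup K] [InnerProductSpace ℂ K]
    (M : Fock n E →L[ℂ] Fock n G) :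
    Fock n (WithLp 2 (E × K)) →L[ℂ] Fock n (WithLp 2 (G × K)) :=
  ampl n (inlL G K) ∘L M ∘L ampl n (WithLp.fstL 2 ℂ E K) +
    ampl n (inrL G K) ∘L ampl n (WithLp.sndL 2 ℂ E K)

theorem diagFock_apply (M : Fock n E →L[ℂ] Fock n G) (z : Fock n (WithLp 2 (E × K)))
    (α : FreeMonoid (Fin n)) :
    diagFock K M z α = WithLp.toLp 2 (M (ampl n (WithLp.fstL 2 ℂ E K) z) α, (z α).snd) := by
  refine withLp_prod_ext ?_ ?_
  · exact add_zero _
  · exact zero_add _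

theorem norm_diagFock_le {M : Fock n E →L[ℂ] Fock n G} (hM : ∀ x, ‖M x‖ ≤ ‖x‖)
    (z : Fock n (WithLp 2 (E × K))) : ‖diagFock K M z‖ ≤ ‖z‖ := by
  have h1 := (norm_sq_eq_tsum (M (ampl n (WithLp.fstL 2 ℂ E K) z))).add
    (norm_sq_eq_tsum (ampl n (WithLp.sndL 2 ℂ E K) z))
  have h2 := (norm_sq_eq_tsum (ampl n (WithLp.fstL 2 ℂ E K) z)).add
    (norm_sq_eq_tsum (ampl n (WithLp.sndL 2 ℂ E K) z))
  have h3 : ‖diagFock K M z‖ ^ 2 = ‖M (ampl n (WithLp.fstL 2 ℂ E K) z)‖ ^ 2 +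
      ‖ampl n (WithLp.sndL 2 ℂ E K) z‖ ^ 2 := by
    refine (norm_sq_eq_tsum _).unique ?_
    convert h1 using 2 with α
    rw [diagFock_apply, norm_sq_toLp]
    rfl
  have h4 : ‖z‖ ^ 2 = ‖ampl n (WithLp.fstL 2 ℂ E K) z‖ ^ 2 +
      ‖ampl n (WithLp.sndL 2 ℂ E K) z‖ ^ 2 := by
    refine (norm_sq_eq_tsum _).unique ?_
    convert h2 using 2 with α
    exact WithLp.prod_norm_sq_eq_of_L2 (z α)
  have h5 := pow_le_pow_left₀ (norm_nonneg _) (hM (ampl n (WithLp.fstL 2 ℂ E K) z)) 2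
  exact (pow_le_pow_iff_left₀ (norm_nonneg _) (norm_nonneg _) two_ne_zero).1 (by linarith)

theorem tendsto_diagFock {M : ℝ → Fock n E →L[ℂ] Fock n G} {M₁ : Fock n E →L[ℂ] Fock n G}
    {l : Filter ℝ} (h : ∀ x, Tendsto (fun r => M r x) l (𝓝 (M₁ x)))
    (z : Fock n (WithLp 2 (E × K))) :
    Tendsto (fun r => diagFock K (M r) z) l (𝓝 (diagFock K M₁ z)) :=
  (((ampl n (inlL G K)).continuous.tendsto _).comp (h _)).add tendsto_const_nhds

/-- Multiplication is jointly strongly continuous only on bounded sets; the eventual contractivity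
of `M r` supplies the bound. -/
theorem tendsto_apply_of_norm_le {X Y : Type*} [NormedAddCommGroup X] [NormedSpace ℂ X]
    [NormedAddCommGroup Y] [NormedSpace ℂ Y] {M : ℝ → X →L[ℂ] Y} {y : Y} {u : ℝ → X} {v : X}
    {l : Filter ℝ} (hM : ∀ᶠ r in l, ∀ x, ‖M r x‖ ≤ ‖x‖) (hu : Tendsto u l (𝓝 v))
    (hv : Tendsto (fun r => M r v) l (𝓝 y)) : Tendsto (fun r => M r (u r)) l (𝓝 y) := by
  have h1 : Tendsto (fun r => ‖u r - v‖) l (𝓝 0) := tendsto_iff_norm_sub_tendsto_zero.1 hu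
  have h2 : Tendsto (fun r => M r (u r - v)) l (𝓝 0) :=
    squeeze_zero_norm' (hM.mono fun r hr => hr _) h1
  simpa using h2.add hv

theorem apply_eq_diagFock_of_tendsto {E₁ E₂ G₁ G₂ X Y : Type*}
    [NormedAddCommGroup E₁] [InnerProductSpace ℂ E₁] [NormedAddCommGroup E₂]
    [InnerProductSpace ℂ E₂] [NormedAddCommGroup G₁] [InnerProductSpace ℂ G₁]
    [NormedAddCommGroup G₂] [InnerProductSpace ℂ G₂] [NormedAddCommGroup X] [NormedSpace ℂ X]
    [NormedAddCommGroup Y] [NormedSpace ℂ Y]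
    {M : ℝ → Fock n E₁ →L[ℂ] Fock n G₁} {M' : Fock n E₁ →L[ℂ] Fock n G₁}
    {N : ℝ → Fock n E₂ →L[ℂ] Fock n G₂} {N' : Fock n E₂ →L[ℂ] Fock n G₂}
    {C : ℝ → X →L[ℂ] Y} {C' : X →L[ℂ] Y} {l : Filter ℝ} [l.NeBot]
    (hM : ∀ x, Tendsto (fun r => M r x) l (𝓝 (M' x)))
    (hN : ∀ x, Tendsto (fun r => N r x) l (𝓝 (N' x)))
    (hC : ∀ x, Tendsto (fun r => C r x) l (𝓝 (C' x)))
    (hN' : ∀ᶠ r in l, ∀ x, ‖N r x‖ ≤ ‖x‖)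
    (U : Fock n (WithLp 2 (G₁ × F)) →L[ℂ] Fock n (WithLp 2 (E₂ × K)))
    (V : Fock n (WithLp 2 (G₂ × K)) →L[ℂ] Y) (x : X) (z : Fock n (WithLp 2 (E₁ × F)))
    (h : ∀ᶠ r in l, C r x = V (diagFock K (N r) (U (diagFock F (M r) z)))) :
    C' x = V (diagFock K N' (U (diagFock F M' z))) := by
  have h1 := (U.continuous.tendsto _).comp (tendsto_diagFock (K := F) hM z)
  have h2 := tendsto_apply_of_norm_le (M := fun r => diagFock K (N r))
    (hN'.mono fun r hr => norm_diagFock_le hr) h1 (tendsto_diagFock hN _)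
  refine tendsto_nhds_unique (hC x) (((V.continuous.tendsto _).comp h2).congr' ?_)
  filter_upwards [h] with r hr
  exact hr.symm

end Product

/-! ### Factorization of the characteristic function on the full Fock space -/

section CascadeTransfer

variable {n : ℕ} {H₁ H₂ F F' : Type*}
  [NormedAddCommGroup H₁] [InnerProductSpace ℂ H₁] [CompleteSpace H₁]
  [NormedAddCommGroup H₂] [InnerProductSpace ℂ H₂] [CompleteSpace H₂]
  [NormedAddCommGroup F] [InnerProductSpace ℂ F] [CompleteSpace F]
  [NormedAddCommGroup F'] [InnerProductSpace ℂ F'] [CompleteSpace F']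
  {A : Fin n → H₁ →L[ℂ] H₁} {B : Fin n → H₂ →L[ℂ] H₂}

set_option maxHeartbeats 1000000 in
/-- If the Julia operator of `T` is unitarily equivalent to the cascade of the Julia operators of
`A` and `B`, then `Θ_T(rR)` is the corresponding product of `Θ_A(rR)` and `Θ_B(rR)`. -/
theorem charR_eq_of_cascade (hA : ‖row A‖ ≤ 1) (hB : ‖row B‖ ≤ 1)
    (w : WithLp 2 (defTstar A × F) ≃ₗᵢ[ℂ] WithLp 2 (defT B × F'))
    {T : Fin n → WithLp 2 (H₁ × H₂) →L[ℂ] WithLp 2 (H₁ × H₂)} (hT : ‖row T‖ ≤ 1)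
    (W : WithLp 2 (defT A × F) →L[ℂ] defT T) (Ws : WithLp 2 (defTstar B × F') →L[ℂ] defTstar T)
    (hstate : ∀ h z, (row T).adjoint h + defect (row T) (W z) =
      mapCopies n (inlL H₁ H₂) ((row A).adjoint h.fst + defect (row A) z.fst) +
        mapCopies n (inrL H₁ H₂) ((row B).adjoint h.snd +
          defect (row B) (linkState w h + linkInput hA w z).fst))
    (hout : ∀ h z, defectCod (row T).adjoint h - feed hT (W z) =
      Ws (WithLp.toLp 2 (defectCod (row B).adjoint h.snd -
        feed hB (linkState w h + linkInput hA w z).fst,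
          (linkState w h + linkInput hA w z).snd)))
    {r : ℝ} (h0 : 0 ≤ r) (h1 : r < 1) (z : Fock n (WithLp 2 (defT A × F))) :
    charR T r (ampl n W z) =
      ampl n Ws (diagFock F' (charR B r)
        (ampl n (w : WithLp 2 (defTstar A × F) →L[ℂ] WithLp 2 (defT B × F'))
          (diagFock F (charR A r) z))) := by
  set x := ampl n (WithLp.fstL 2 ℂ (defT A) F) z with hx
  obtain ⟨h₁, hh₁⟩ := exists_state hA h0 h1 (ampl n (defT A).subtypeL x)
  set v : Fock n (WithLp 2 (defT B × F')) :=
    ampl n (w : WithLp 2 (defTstar A × F) →L[ℂ] WithLp 2 (defT B × F'))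
      (diagFock F (charR A r) z) with hv
  set y := ampl n (WithLp.fstL 2 ℂ (defT B) F') v with hy
  obtain ⟨h₂, hh₂⟩ := exists_state hB h0 h1 (ampl n (defT B).subtypeL y)
  set h : Fock n (WithLp 2 (H₁ × H₂)) := ampl n (inlL H₁ H₂) h₁ + ampl n (inrL H₁ H₂) h₂ with hh
  have hf : ∀ α, (h α).fst = h₁ α := fun α => add_zero _
  have hs : ∀ α, (h α).snd = h₂ α := fun α => zero_add _
  have hvα : ∀ α, v α = linkState w (h α) + linkInput hA w (z α) := fun α => by
    rw [link_eq, hv, ampl_apply, diagFock_apply, charR_eq_of_state hA h0 h1 hh₁, hf]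
    rfl
  -- The pair of the states of `A` and `B` solves the state equation of `T`, because the right
  -- creation operators act on the word and commute with the embeddings of the two summands.
  have hst : h = (r : ℂ) • rightRow n _ (ampl n (row T).adjoint h +
      ampl n (defect (row T)) (ampl n (defT T).subtypeL (ampl n W z))) := by
    have e : ampl n (row T).adjoint h +
        ampl n (defect (row T)) (ampl n (defT T).subtypeL (ampl n W z)) =
        ampl n (mapCopies n (inlL H₁ H₂)) (ampl n (row A).adjoint h₁ +
          ampl n (defect (row A)) (ampl n (defT A).subtypeL x)) +
        ampl n (mapCopies n (inrL H₁ H₂)) (ampl n (row B).adjoint h₂ +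
          ampl n (defect (row B)) (ampl n (defT B).subtypeL y)) := by
      refine lp.ext (funext fun α => ?_)
      change (row T).adjoint (h α) + defect (row T) (W (z α)) =
        mapCopies n (inlL H₁ H₂) ((row A).adjoint (h₁ α) + defect (row A) (z α).fst) +
        mapCopies n (inrL H₁ H₂) ((row B).adjoint (h₂ α) + defect (row B) (v α).fst)
      rw [hstate, hf, hs, hvα]
    rw [e, map_add, smul_add, rightRow_ampl_mapCopies, rightRow_ampl_mapCopies,
      ← map_smul (ampl n (inlL H₁ H₂)), ← map_smul (ampl n (inrL H₁ H₂)), ← hh₁, ← hh₂]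
  refine lp.ext (funext fun α => ?_)
  rw [charR_eq_of_state hT h0 h1 hst, ampl_apply, ampl_apply, diagFock_apply,
    charR_eq_of_state hB h0 h1 hh₂, hout, ← hvα, hs]
  rfl

-- The identity holds for every `0 < r < 1`, and the strong limit passes through the product since
-- `Θ_B(rR)` is contractive.
set_option maxHeartbeats 1000000 in
theorem charFun_eq_of_cascade (hA : ‖row A‖ ≤ 1) (hB : ‖row B‖ ≤ 1)
    (w : WithLp 2 (defTstar A × F) ≃ₗᵢ[ℂ] WithLp 2 (defT B × F'))
    {T : Fin n → WithLp 2 (H₁ × H₂) →L[ℂ] WithLp 2 (H₁ × H₂)} (hT : ‖row T‖ ≤ 1)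
    (W : WithLp 2 (defT A × F) →L[ℂ] defT T) (Ws : WithLp 2 (defTstar B × F') →L[ℂ] defTstar T)
    (hstate : ∀ h z, (row T).adjoint h + defect (row T) (W z) =
      mapCopies n (inlL H₁ H₂) ((row A).adjoint h.fst + defect (row A) z.fst) +
        mapCopies n (inrL H₁ H₂) ((row B).adjoint h.snd +
          defect (row B) (linkState w h + linkInput hA w z).fst))
    (hout : ∀ h z, defectCod (row T).adjoint h - feed hT (W z) =
      Ws (WithLp.toLp 2 (defectCod (row B).adjoint h.snd -
        feed hB (linkState w h + linkInput hA w z).fst,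
          (linkState w h + linkInput hA w z).snd)))
    (z : Fock n (WithLp 2 (defT A × F))) :
    charFun T (ampl n W z) =
      ampl n Ws (diagFock F' (charFun B)
        (ampl n (w : WithLp 2 (defTstar A × F) →L[ℂ] WithLp 2 (defT B × F'))
          (diagFock F (charFun A) z))) := by
  have hev : ∀ᶠ r : ℝ in 𝓝[<] 1, r ∈ Set.Ioo (0 : ℝ) 1 := Ioo_mem_nhdsLT zero_lt_one
  have h1 : ∀ᶠ r : ℝ in 𝓝[<] 1, ∀ x, ‖charR B r x‖ ≤ ‖x‖ := by
    filter_upwards [hev] with r hr x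
    exact norm_charR_le hB hr.1.le hr.2 x
  refine apply_eq_diagFock_of_tendsto (F := F) (K := F') (M := charR A)
    (M' := charFun A) (N := charR B) (N' := charFun B) (C := charR T) (C' := charFun T)
    (l := 𝓝[<] (1 : ℝ)) (charFun_tendsto hA) (charFun_tendsto hB) (charFun_tendsto hT) h1
    (ampl n (w : WithLp 2 (defTstar A × F) →L[ℂ] WithLp 2 (defT B × F'))) (ampl n Ws)
    (ampl n W z) z ?_
  filter_upwards [hev] with r hr
  exact charR_eq_of_cascade hA hB w hT W Ws hstate hout hr.1.le hr.2 z

/-- If the product of the values at the vacuum is strictly contractive on nonzero vectors, then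
`Θ_T` for the upper triangular tuple coincides with the product of `Θ_A` and `Θ_B`. -/
theorem exists_charFun_upperOf (hA : ‖row A‖ ≤ 1) (hB : ‖row B‖ ≤ 1)
    (w : WithLp 2 (defTstar A × F) ≃ₗᵢ[ℂ] WithLp 2 (defT B × F'))
    (hT : ‖row (upperOf A B (corner w))‖ ≤ 1)
    (hpure : ∀ η, η ≠ 0 → ‖cascadeFeed hA hB w η‖ < ‖η‖) :
    ∃ (W : WithLp 2 (defT A × F) ≃ₗᵢ[ℂ] defT (upperOf A B (corner w)))
      (Ws : WithLp 2 (defTstar B × F') ≃ₗᵢ[ℂ] defTstar (upperOf A B (corner w))),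
      ∀ z, charFun (upperOf A B (corner w))
        (ampl n (W : WithLp 2 (defT A × F) →L[ℂ] defT (upperOf A B (corner w))) z) =
        ampl n (Ws : WithLp 2 (defTstar B × F') →L[ℂ] defTstar (upperOf A B (corner w)))
          (diagFock F' (charFun B)
            (ampl n (w : WithLp 2 (defTstar A × F) →L[ℂ] WithLp 2 (defT B × F'))
              (diagFock F (charFun A) z))) := by
  obtain ⟨W, Ws, hW, hc, hd⟩ := exists_unitary_of_colligation hT (cascadeInput (B := B) hA w)
    (cascadeOutput hB w) (cascadeFeed hA hB w) (norm_sq_cascade hA hB w)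
    (cascade_surjective hA hB w) hpure
  refine ⟨W, Ws, charFun_eq_of_cascade hA hB w hT _ _ (fun h z => ?_) fun h z => ?_⟩
  · rw [← cascade_eq, ← hW]
    rfl
  · rw [← cascade_output_eq]
    refine Subtype.ext ?_
    change defect (row (upperOf A B (corner w))).adjoint h - row (upperOf A B (corner w)) (W z) =
      (Ws (cascadeOutput hB w h + cascadeFeed hA hB w z) : WithLp 2 (H₁ × H₂))
    rw [map_add, Submodule.coe_add, hc, hd, sub_eq_add_neg]

end CascadeTransfer

/-! ### Commutation with left creation operators and invariance of `M_J` -/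

section Commutant

variable {n : ℕ} {H E F : Type*}
  [NormedAddCommGroup H] [InnerProductSpace ℂ H] [CompleteSpace H]
  [NormedAddCommGroup E] [InnerProductSpace ℂ E] [NormedAddCommGroup F] [InnerProductSpace ℂ F]

theorem shift_shift {s t : FreeMonoid (Fin n) → FreeMonoid (Fin n)} (hs : Function.Injective s)
    (ht : Function.Injective t) (f : Fock n E) :
    shift hs (shift ht f) = shift (hs.comp ht) f := by
  refine lp.ext (funext fun α => ?_)
  by_cases h : ∃ β, s β = α
  · obtain ⟨β, rfl⟩ := h
    rw [shift_apply]
    by_cases h' : ∃ γ, t γ = β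
    · obtain ⟨γ, rfl⟩ := h'
      rw [shift_apply]
      exact (shift_apply (hs.comp ht) f γ).symm
    · rw [shift_apply_of_notMem ht _ _ h', shift_apply_of_notMem]
      rintro ⟨γ, hγ⟩
      exact h' ⟨γ, hs hγ⟩
  · rw [shift_apply_of_notMem hs _ _ h, shift_apply_of_notMem]
    rintro ⟨γ, hγ⟩
    exact h ⟨t γ, hγ⟩

theorem leftCreation_rightCreation (i j : Fin n) (f : Fock n E) :
    leftCreation E i (rightCreation E j f) = rightCreation E j (leftCreation E i f) := by
  change shift (mul_right_injective (FreeMonoid.of i))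
    (shift (mul_left_injective (FreeMonoid.of j)) f) =
    shift (mul_left_injective (FreeMonoid.of j))
      (shift (mul_right_injective (FreeMonoid.of i)) f)
  rw [shift_shift, shift_shift]
  congr 2

theorem leftCreation_ampl (Y : E →L[ℂ] F) (j : Fin n) (f : Fock n E) :
    leftCreation F j (ampl n Y f) = ampl n Y (leftCreation E j f) :=
  shift_ampl (mul_right_injective (FreeMonoid.of j)) Y f

theorem leftCreation_rightRow (i : Fin n) (f : Fock n (Copies n H)) :
    leftCreation H i (rightRow n H f) = rightRow n H (leftCreation (Copies n H) i f) := by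
  rw [rightRow_eq_sum, rightRow_eq_sum, map_sum]
  refine Finset.sum_congr rfl fun j _ => ?_
  rw [leftCreation_rightCreation, leftCreation_ampl]

/-- Left creations commute with right creations and with coefficient operators, so `L_i` maps a
state for `x` to a state for `L_i x`. -/
theorem charR_leftCreation {T : Fin n → H →L[ℂ] H} (hT : ‖row T‖ ≤ 1) {r : ℝ} (h0 : 0 ≤ r)
    (h1 : r < 1) (i : Fin n) (x : Fock n (defT T)) :
    charR T r (leftCreation _ i x) = leftCreation _ i (charR T r x) := by
  obtain ⟨h, hh⟩ := exists_state hT h0 h1 (ampl n (defT T).subtypeL x)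
  have hh' : leftCreation H i h = (r : ℂ) • rightRow n H (ampl n (row T).adjoint
      (leftCreation H i h) + ampl n (defect (row T)) (ampl n (defT T).subtypeL
        (leftCreation (defT T) i x))) := by
    rw [← leftCreation_ampl, ← leftCreation_ampl, ← leftCreation_ampl, ← map_add,
      ← leftCreation_rightRow, ← map_smul, ← hh]
  have e1 : charR T r x = ampl n (defectCod (row T).adjoint) h - ampl n (feed hT) x :=
    lp.ext (funext fun α => charR_eq_of_state hT h0 h1 hh α)
  have e2 : charR T r (leftCreation _ i x) = ampl n (defectCod (row T).adjoint)
      (leftCreation H i h) - ampl n (feed hT) (leftCreation _ i x) :=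
    lp.ext (funext fun α => charR_eq_of_state hT h0 h1 hh' α)
  rw [e1, e2, map_sub, leftCreation_ampl, leftCreation_ampl]

theorem charFun_leftCreation {T : Fin n → H →L[ℂ] H} (hT : ‖row T‖ ≤ 1) (i : Fin n)
    (x : Fock n (defT T)) :
    charFun T (leftCreation _ i x) = leftCreation _ i (charFun T x) := by
  have hev : ∀ᶠ r : ℝ in 𝓝[<] 1, r ∈ Set.Ioo (0 : ℝ) 1 := Ioo_mem_nhdsLT zero_lt_one
  refine tendsto_nhds_unique (charFun_tendsto hT _)
    ((((leftCreation (defTstar T) i).continuous.tendsto _).comp (charFun_tendsto hT x)).congr' ?_)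
  filter_upwards [hev] with r hr
  exact (charR_leftCreation hT hr.1.le hr.2 i x).symm

theorem charFun_apply_one {T : Fin n → H →L[ℂ] H} (hT : ‖row T‖ ≤ 1) (x : Fock n (defT T)) :
    charFun T x 1 = - feed hT (x 1) := by
  have hev : ∀ᶠ r : ℝ in 𝓝[<] 1, r ∈ Set.Ioo (0 : ℝ) 1 := Ioo_mem_nhdsLT zero_lt_one
  have h1 := ((lp.evalCLM ℂ (fun _ : FreeMonoid (Fin n) => defTstar T) 2 1).continuous.tendsto
    _).comp (charFun_tendsto hT x)
  refine tendsto_nhds_unique h1 (tendsto_const_nhds.congr' ?_)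
  filter_upwards [hev] with r hr
  obtain ⟨h, hh⟩ := exists_state hT hr.1.le hr.2 (ampl n (defT T).subtypeL x)
  have h2 : h 1 = 0 := by
    rw [hh]
    change (r : ℂ) • (rightRow n H _ 1) = 0
    rw [rightRow_apply_one, smul_zero]
  change _ = charR T r x 1
  rw [charR_eq_of_state hT hr.1.le hr.2 hh, h2, map_zero, zero_sub]

/-- The commutant of `S` is an algebra containing every `L_j`, and it is closed both in norm and in
the weak operator topology. -/
theorem commute_of_mem_toeplitzAlgebra {S : Gam n →L[ℂ] Gam n}
    (hS : ∀ j f, S (leftCreation ℂ j f) = leftCreation ℂ j (S f)) {X : Gam n →L[ℂ] Gam n}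
    (hX : X ∈ toeplitzAlgebra n) (f : Gam n) : S (X f) = X (S f) := by
  have h1 : Algebra.adjoin ℂ (Set.range fun j : Fin n => leftCreation ℂ j) ≤
      Subalgebra.centralizer ℂ {S} := by
    refine Algebra.adjoin_le ?_
    rintro _ ⟨j, rfl⟩
    refine (Subalgebra.mem_centralizer_iff ℂ).2 ?_
    rintro _ rfl
    exact ContinuousLinearMap.ext fun f => hS j f
  have h2 : discAlgebra n ≤ Subalgebra.centralizer ℂ {S} := by
    refine Subalgebra.topologicalClosure_minimal h1 ?_
    have : ((Subalgebra.centralizer ℂ {S} : Subalgebra ℂ (Gam n →L[ℂ] Gam n)) :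
        Set (Gam n →L[ℂ] Gam n)) = {X | S * X = X * S} := by
      ext X
      simp [Set.mem_centralizer_iff]
    rw [this]
    exact isClosed_eq (continuous_const.mul continuous_id) (continuous_id.mul continuous_const)
  refine ext_inner_left ℂ fun g => ?_
  rw [← ContinuousLinearMap.adjoint_inner_left]
  -- Moving `S` to the left vector as `S*` expresses commutation through matrix coefficients of `X`,
  -- which are continuous in the weak operator topology.
  have hcl : IsClosed {X : Gam n →WOT[ℂ] Gam n | ⟪S.adjoint g, X f⟫_ℂ = ⟪g, X (S f)⟫_ℂ} :=
    isClosed_eq (ContinuousLinearMapWOT.continuous_dual_apply f (innerSL ℂ (S.adjoint g)))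
      (ContinuousLinearMapWOT.continuous_dual_apply (S f) (innerSL ℂ g))
  refine closure_minimal ?_ hcl hX
  rintro _ ⟨Y, hY, rfl⟩
  change ⟪S.adjoint g, Y f⟫_ℂ = ⟪g, Y (S f)⟫_ℂ
  have h3 := (Subalgebra.mem_centralizer_iff ℂ).1 (h2 hY) S rfl
  have h4 : S (Y f) = Y (S f) := congrArg (fun Z => Z f) h3
  rw [ContinuousLinearMap.adjoint_inner_left, h4]

theorem vacuum_ne_zero : vacuum n ≠ 0 := by
  intro h
  have := congrArg (fun f : Gam n => f 1) h
  simp [vacuum] at this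

theorem genIdeal_subset_toeplitzAlgebra {P : Set (FreeAlgebra ℂ (Fin n))}
    (he : vacuum n ∈ NJ P) {φ : Gam n →L[ℂ] Gam n} (hφ : φ ∈ genIdeal P) :
    φ ∈ toeplitzAlgebra n := by
  by_cases h : ∃ I, IsWOTClosedIdeal I ∧
      ∀ p ∈ P, FreeAlgebra.lift ℂ (fun j : Fin n => leftCreation ℂ j) p ∈ I
  · obtain ⟨I, hI⟩ := h
    exact hI.1.1 (Submodule.mem_sInf.1 hφ I hI)
  -- An infimum over an empty family of ideals would be the whole operator space. Then the vacuum
  -- would lie in `M_J`, against the assumption that it lies in `N_J`.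
  · have h1 : (1 : Gam n →L[ℂ] Gam n) ∈ genIdeal P :=
      Submodule.mem_sInf.2 fun I hI => (h ⟨I, hI⟩).elim
    have h2 : vacuum n ∈ MJ P :=
      Submodule.le_topologicalClosure _ (Submodule.subset_span ⟨1, h1, vacuum n, rfl⟩)
    exact (vacuum_ne_zero (inner_self_eq_zero.1 (he _ h2))).elim

/-- Since `S` commutes with `φ ∈ J`, one has `S (φ ψ) = φ (S ψ)`. -/
theorem apply_mem_MJ {P : Set (FreeAlgebra ℂ (Fin n))} (he : vacuum n ∈ NJ P)
    {S : Gam n →L[ℂ] Gam n} (hS : ∀ j f, S (leftCreation ℂ j f) = leftCreation ℂ j (S f))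
    {m : Gam n} (hm : m ∈ MJ P) : S m ∈ MJ P := by
  have hc : IsClosed ((MJ P).comap (S : Gam n →ₗ[ℂ] Gam n) : Set (Gam n)) :=
    (Submodule.isClosed_topologicalClosure _).preimage S.continuous
  refine Submodule.topologicalClosure_minimal _ (Submodule.span_le.2 ?_) hc hm
  rintro _ ⟨φ, hφ, ψ, rfl⟩
  change S (φ ψ) ∈ MJ P
  rw [commute_of_mem_toeplitzAlgebra hS (genIdeal_subset_toeplitzAlgebra he hφ)]
  exact Submodule.le_topologicalClosure _ (Submodule.subset_span ⟨φ, hφ, S ψ, rfl⟩)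

end Commutant

/-! ### The complement of `N_J ⊗ E` and the operators preserving it -/

section Coinvariant

variable {n : ℕ} {E F G K : Type*} [NormedAddCommGroup E] [InnerProductSpace ℂ E]
  [NormedAddCommGroup F] [InnerProductSpace ℂ F]
  [NormedAddCommGroup G] [InnerProductSpace ℂ G]
  [NormedAddCommGroup K] [InnerProductSpace ℂ K]
  {P : Set (FreeAlgebra ℂ (Fin n))}

instance : CompleteSpace (MJ P) :=
  inferInstanceAs (CompleteSpace
    ((Submodule.span ℂ {x | ∃ φ ∈ genIdeal P, ∃ ψ : Gam n, x = φ ψ}).topologicalClosure))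

theorem NJ_orthogonal : (NJ P)ᗮ = MJ P :=
  (MJ P).orthogonal_orthogonal

theorem inner_tens_left (f : Gam n) (ξ : E) (y : Fock n E) :
    ⟪tens f ξ, y⟫_ℂ = ⟪f, ampl n (innerSL ℂ ξ) y⟫_ℂ := by
  rw [lp.inner_eq_tsum, lp.inner_eq_tsum]
  refine tsum_congr fun α => ?_
  simp only [tens_apply, ampl_apply, inner_smul_left, innerSL_apply_apply, RCLike.inner_apply]
  ring

/-- Pairing `y` with `f ⊗ ξ` equals pairing its scalar slice along `ξ` with `f`. This reduces
vector-valued questions to `M_J` itself. -/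
theorem mem_NTens_orthogonal_iff {y : Fock n E} :
    y ∈ (NTens P E)ᗮ ↔ ∀ ξ : E, ampl n (innerSL ℂ ξ) y ∈ MJ P := by
  rw [NTens, Submodule.orthogonal_closure, ← NJ_orthogonal]
  constructor
  · intro h ξ f hf
    rw [← inner_tens_left]
    exact h _ (Submodule.subset_span ⟨f, hf, ξ, rfl⟩)
  · intro h
    rw [Submodule.mem_orthogonal]
    intro u hu
    have : Submodule.span ℂ {x | ∃ f ∈ NJ P, ∃ η : E, x = tens f η} ≤ (ℂ ∙ y)ᗮ := by
      rw [Submodule.span_le]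
      rintro _ ⟨f, hf, η, rfl⟩
      rw [SetLike.mem_coe, Submodule.mem_orthogonal_singleton_iff_inner_left, inner_tens_left]
      exact h η f hf
    exact Submodule.mem_orthogonal_singleton_iff_inner_left.1 (this hu)

theorem tens_mem_NTens_orthogonal {m : Gam n} (hm : m ∈ MJ P) (η : E) :
    tens m η ∈ (NTens P E)ᗮ := by
  refine mem_NTens_orthogonal_iff.2 fun ξ => ?_
  have : ampl n (innerSL ℂ ξ) (tens m η) = ⟪ξ, η⟫_ℂ • m := by
    refine lp.ext (funext fun α => ?_)
    change ⟪ξ, m α • η⟫_ℂ = ⟪ξ, η⟫_ℂ * m α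
    rw [inner_smul_right, mul_comm]
  rw [this]
  exact Submodule.smul_mem _ _ hm

theorem single_eq_tens (α : FreeMonoid (Fin n)) (η : E) :
    (lp.single 2 α η : Fock n E) = tens (lp.single 2 α (1 : ℂ)) η := by
  refine lp.ext (funext fun β => ?_)
  rw [tens_apply]
  by_cases h : β = α
  · subst h
    rw [lp.single_apply_self, lp.single_apply_self, one_smul]
  · rw [lp.single_apply_ne _ _ _ h, lp.single_apply_ne _ _ _ h, zero_smul]

/-- The projection onto the complement maps `f ⊗ η` to `(P_{M_J} f) ⊗ η`. Elementary tensors span a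
dense subspace and the projection fixes `x`, so `x` is a limit of combinations of tensors from
`M_J`. -/
theorem mem_closure_of_mem_NTens_orthogonal [CompleteSpace E] {x : Fock n E}
    (hx : x ∈ (NTens P E)ᗮ) :
    x ∈ (Submodule.span ℂ {y | ∃ m ∈ MJ P, ∃ η : E, y = tens m η}).topologicalClosure := by
  set V := (Submodule.span ℂ {y | ∃ m ∈ MJ P, ∃ η : E, y = tens m η}).topologicalClosure
  set D : Fock n E →L[ℂ] Fock n E := ContinuousLinearMap.id ℂ _ - (NTens P E).starProjection
    with hD
  have hDt : ∀ (f : Gam n) (η : E), D (tens f η) ∈ V := by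
    intro f η
    have e1 : f = (MJ P).starProjection f + (f - (MJ P).starProjection f) := by abel
    set m := (MJ P).starProjection f
    have hm : m ∈ MJ P := (MJ P).starProjection_apply_mem f
    have hf : f - m ∈ NJ P := (MJ P).sub_starProjection_mem_orthogonal f
    have e2 : tens f η = tens m η + tens (f - m) η := by
      rw [tens, tens, tens, ← map_add, add_sub_cancel]
    have e3 : (NTens P E).starProjection (tens f η) = tens (f - m) η := by
      refine (Submodule.eq_starProjection_of_mem_orthogonal (tens_mem hf η) ?_)
      rw [e2, add_sub_cancel_right]
      exact tens_mem_NTens_orthogonal hm η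
    have e4 : D (tens f η) = tens m η := by
      change tens f η - (NTens P E).starProjection (tens f η) = _
      rw [e3, e2, add_sub_cancel_right]
    rw [e4]
    exact Submodule.le_topologicalClosure _ (Submodule.subset_span ⟨m, hm, η, rfl⟩)
  have hall : ∀ y, D y ∈ V := by
    intro y
    have hc : IsClosed (V.comap (D : Fock n E →ₗ[ℂ] Fock n E) : Set (Fock n E)) :=
      (Submodule.isClosed_topologicalClosure _).preimage D.continuous
    have hsum := lp.hasSum_single (p := 2) (by norm_num) y
    refine hc.mem_of_tendsto hsum (Eventually.of_forall fun s => ?_)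
    refine Submodule.sum_mem (V.comap (D : Fock n E →ₗ[ℂ] Fock n E)) fun α _ => ?_
    rw [single_eq_tens]
    exact hDt _ _
  have hDx : D x = x := by
    change x - (NTens P E).starProjection x = x
    rw [(NTens P E).starProjection_apply_eq_zero_iff.2 hx, sub_zero]
  rw [← hDx]
  exact hall x

/-- An operator that maps `M_J ⊗ E` into `M_J ⊗ F`, where `M_J ⊗ E` is the complement
of `N_J ⊗ E`. -/
def PreservesMJ (P : Set (FreeAlgebra ℂ (Fin n))) (S : Fock n E →L[ℂ] Fock n F) : Prop :=
  ∀ x ∈ (NTens P E)ᗮ, S x ∈ (NTens P F)ᗮ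

theorem preservesMJ_of_tens [CompleteSpace E] {S : Fock n E →L[ℂ] Fock n F}
    (h : ∀ m ∈ MJ P, ∀ η : E, S (tens m η) ∈ (NTens P F)ᗮ) : PreservesMJ P S := by
  intro x hx
  have hc : IsClosed (((NTens P F)ᗮ).comap (S : Fock n E →ₗ[ℂ] Fock n F) : Set (Fock n E)) :=
    (Submodule.isClosed_orthogonal _).preimage S.continuous
  refine Submodule.topologicalClosure_minimal _ (Submodule.span_le.2 ?_) hc
    (mem_closure_of_mem_NTens_orthogonal hx)
  rintro _ ⟨m, hm, η, rfl⟩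
  exact h m hm η

theorem preservesMJ_ampl [CompleteSpace E] (X : E →L[ℂ] F) : PreservesMJ P (ampl n X) :=
  preservesMJ_of_tens fun m hm η => by
    rw [ampl_tens]
    exact tens_mem_NTens_orthogonal hm _

/-- Each scalar slice of `S`, with input along `η` and output along `ξ`, commutes with the left
creations on `Γ`, and `apply_mem_MJ` applies to it. -/
theorem preservesMJ_of_leftCreation [CompleteSpace E] (he : vacuum n ∈ NJ P)
    {S : Fock n E →L[ℂ] Fock n F}
    (hS : ∀ j f, S (leftCreation E j f) = leftCreation F j (S f)) : PreservesMJ P S := by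
  refine preservesMJ_of_tens fun m hm η => mem_NTens_orthogonal_iff.2 fun ξ => ?_
  refine apply_mem_MJ he (S := ampl n (innerSL ℂ ξ) ∘L S ∘L
    ampl n (ContinuousLinearMap.toSpanSingleton ℂ η)) (fun j f => ?_) hm
  change ampl n (innerSL ℂ ξ) (S (ampl n (ContinuousLinearMap.toSpanSingleton ℂ η)
    (leftCreation ℂ j f))) = leftCreation ℂ j (ampl n (innerSL ℂ ξ) (S (ampl n
      (ContinuousLinearMap.toSpanSingleton ℂ η) f)))
  rw [← leftCreation_ampl, hS, leftCreation_ampl]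

end Coinvariant

/-! ### Multiplicativity of compression to `N_J` -/

section Compression

variable {n : ℕ} {E F G K : Type*} [NormedAddCommGroup E] [InnerProductSpace ℂ E]
  [NormedAddCommGroup F] [InnerProductSpace ℂ F]
  [NormedAddCommGroup G] [InnerProductSpace ℂ G]
  [NormedAddCommGroup K] [InnerProductSpace ℂ K]
  {P : Set (FreeAlgebra ℂ (Fin n))}

/-- The compression of `M : Γ ⊗ E → Γ ⊗ G` to `N_J ⊗ E → N_J ⊗ G`. -/
def compress (P : Set (FreeAlgebra ℂ (Fin n))) [CompleteSpace G] (M : Fock n E →L[ℂ] Fock n G) :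
    NTens P E →L[ℂ] NTens P G :=
  (NTens P G).orthogonalProjectionOnto ∘L M ∘L (NTens P E).subtypeL

/-- An operator preserving the complements acts on congruence classes modulo them, and its
compression represents that action. Stated for any `x` congruent to `z`, the lemma can be chained
along a product of compressions. -/
theorem compress_sub_mem [CompleteSpace G] {M : Fock n E →L[ℂ] Fock n G} (hM : PreservesMJ P M)
    (z : NTens P E) {x : Fock n E} (hx : (z : Fock n E) - x ∈ (NTens P E)ᗮ) :
    (compress P M z : Fock n G) - M x ∈ (NTens P G)ᗮ := by
  have h1 := (NTens P G).sub_starProjection_mem_orthogonal (M z)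
  have h2 := hM _ hx
  have h3 := sub_mem h2 h1
  have h4 : M ((z : Fock n E) - x) - (M z - (NTens P G).starProjection (M z)) =
      (NTens P G).starProjection (M z) - M x := by
    rw [map_sub]; abel
  rw [h4] at h3
  exact h3

theorem NAmpl_sub_mem [CompleteSpace E] (X : E →L[ℂ] F) (z : NTens P E) {x : Fock n E}
    (hx : (z : Fock n E) - x ∈ (NTens P E)ᗮ) :
    (NAmpl P X z : Fock n F) - ampl n X x ∈ (NTens P F)ᗮ := by
  have := preservesMJ_ampl (P := P) X _ hx
  rwa [map_sub] at this

theorem diagI_compress_sub_mem [CompleteSpace E] [CompleteSpace G] [CompleteSpace K]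
    {M : Fock n E →L[ℂ] Fock n G} (hM : PreservesMJ P M) (z : NTens P (WithLp 2 (E × K)))
    {x : Fock n (WithLp 2 (E × K))} (hx : (z : Fock n (WithLp 2 (E × K))) - x ∈ (NTens P _)ᗮ) :
    (diagI P K (compress P M) z : Fock n (WithLp 2 (G × K))) - diagFock K M x ∈ (NTens P _)ᗮ := by
  have h1 := NAmpl_sub_mem (inlL G K) _
    (compress_sub_mem hM _ (NAmpl_sub_mem (WithLp.fstL 2 ℂ E K) z hx))
  have h2 := NAmpl_sub_mem (inrL G K) _ (NAmpl_sub_mem (WithLp.sndL 2 ℂ E K) z hx)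
  have h3 := add_mem h1 h2
  rw [← add_sub_add_comm] at h3
  exact h3

/-- Both sides lie in `N_J ⊗ Y` and are congruent modulo its orthogonal complement, so their
difference is orthogonal to itself. -/
theorem NAmpl_eq_compress_of_sub_mem {X Y : Type*} [NormedAddCommGroup X]
    [InnerProductSpace ℂ X] [NormedAddCommGroup Y] [InnerProductSpace ℂ Y] [CompleteSpace E]
    [CompleteSpace G] [CompleteSpace Y] {M : Fock n X →L[ℂ] Fock n Y}
    (hM : PreservesMJ P M) (W : E →L[ℂ] X) (V : G →L[ℂ] Y) (z : NTens P E) (u : NTens P G)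
    {x : Fock n G} (hu : (u : Fock n G) - x ∈ (NTens P G)ᗮ)
    (h : M (ampl n W z) = ampl n V x) : NAmpl P V u = compress P M (NAmpl P W z) := by
  have h1 := NAmpl_sub_mem V u hu
  have h2 := compress_sub_mem hM (NAmpl P W z) (x := ampl n W z) (by
    change ampl n W z - ampl n W z ∈ _
    rw [sub_self]
    exact zero_mem _)
  rw [h] at h2
  have h3 := sub_mem h1 h2
  rw [sub_sub_sub_cancel_right] at h3
  refine Subtype.ext (sub_eq_zero.1 (inner_self_eq_zero.1
    (h3 _ (sub_mem (NAmpl P V u).2 (compress P M (NAmpl P W z)).2))))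

/-- The vector `e_∅ ⊗ y_∅` lies in `N_J ⊗ E`, and its inner product with `y` is `‖y_∅‖²`. Vacuum
coefficients are thus unaffected by compression. -/
theorem apply_one_eq_zero (he : vacuum n ∈ NJ P) {y : Fock n E} (hy : y ∈ (NTens P E)ᗮ) :
    y 1 = 0 := by
  have h := hy _ (tens_mem he (y 1))
  rw [vacuum, ← single_eq_tens, lp.inner_single_left] at h
  exact inner_self_eq_zero.1 h

theorem tens_vacuum_apply_one (η : E) : (tens (vacuum n) η : Fock n E) 1 = η := by
  rw [vacuum, ← single_eq_tens, lp.single_apply_self]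

theorem norm_tens_vacuum (η : E) : ‖(tens (vacuum n) η : Fock n E)‖ = ‖η‖ := by
  rw [vacuum, ← single_eq_tens, lp.norm_single (by norm_num)]

end Compression

/-! ### The constrained product and its vacuum coefficient -/

section Main

variable {n : ℕ} {P : Set (FreeAlgebra ℂ (Fin n))} {H₁ H₂ F F' : Type*}
  [NormedAddCommGroup H₁] [InnerProductSpace ℂ H₁] [CompleteSpace H₁]
  [NormedAddCommGroup H₂] [InnerProductSpace ℂ H₂] [CompleteSpace H₂]
  [NormedAddCommGroup F] [InnerProductSpace ℂ F] [CompleteSpace F]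
  [NormedAddCommGroup F'] [InnerProductSpace ℂ F'] [CompleteSpace F']
  {A : Fin n → H₁ →L[ℂ] H₁} {B : Fin n → H₂ →L[ℂ] H₂}

theorem preservesMJ_charFun (he : vacuum n ∈ NJ P) (hA : ‖row A‖ ≤ 1) :
    PreservesMJ P (charFun A) :=
  preservesMJ_of_leftCreation he (charFun_leftCreation hA)

theorem prodChar_sub_mem (he : vacuum n ∈ NJ P) (hA : ‖row A‖ ≤ 1) (hB : ‖row B‖ ≤ 1)
    (w : WithLp 2 (defTstar A × F) ≃ₗᵢ[ℂ] WithLp 2 (defT B × F'))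
    (z : NTens P (WithLp 2 (defT A × F))) :
    (prodChar P A B w z : Fock n (WithLp 2 (defTstar B × F'))) -
      diagFock F' (charFun B)
        (ampl n (w : WithLp 2 (defTstar A × F) →L[ℂ] WithLp 2 (defT B × F'))
          (diagFock F (charFun A) (z : Fock n (WithLp 2 (defT A × F))))) ∈ (NTens P _)ᗮ := by
  have h0 : (z : Fock n (WithLp 2 (defT A × F))) - z ∈ (NTens P (WithLp 2 (defT A × F)))ᗮ := by
    rw [sub_self]
    exact zero_mem _
  have h1 := diagI_compress_sub_mem (preservesMJ_charFun he hA) z h0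
  have h2 := NAmpl_sub_mem (w : WithLp 2 (defTstar A × F) →L[ℂ] WithLp 2 (defT B × F')) _ h1
  exact diagI_compress_sub_mem (preservesMJ_charFun he hB) _ h2

/-- The vacuum coefficient of the constrained product agrees with that of the product on the full
Fock space, where each characteristic function contributes its feedthrough `-A` or `-B`. This turns
pure contractivity into the condition on the cascade. -/
theorem prodChar_vacuum (he : vacuum n ∈ NJ P) (hA : ‖row A‖ ≤ 1) (hB : ‖row B‖ ≤ 1)
    (w : WithLp 2 (defTstar A × F) ≃ₗᵢ[ℂ] WithLp 2 (defT B × F'))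
    (η : WithLp 2 (defT A × F)) :
    (prodChar P A B w ⟨tens (vacuum n) η, tens_mem he η⟩ : Fock n (WithLp 2 (defTstar B × F'))) 1 =
      cascadeFeed hA hB w η := by
  have h1 := apply_one_eq_zero he
    (prodChar_sub_mem he hA hB w ⟨tens (vacuum n) η, tens_mem he η⟩)
  rw [lp.coeFn_sub, Pi.sub_apply, sub_eq_zero] at h1
  rw [h1, diagFock_apply, charFun_apply_one hB]
  have h2 : (ampl n (w : WithLp 2 (defTstar A × F) →L[ℂ] WithLp 2 (defT B × F'))
      (diagFock F (charFun A) (tens (vacuum n) η))) 1 = linkInput hA w η := by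
    rw [ampl_apply, diagFock_apply, charFun_apply_one hA, ampl_apply, tens_vacuum_apply_one]
    change w _ = w (diagFeed hA F η)
    congr 1
    exact withLp_prod_ext (diagFeed_fst hA η).symm (diagFeed_snd hA η).symm
  rw [ampl_apply (WithLp.fstL 2 ℂ (defT B) F'), h2]
  exact withLp_prod_ext (diagFeed_fst hB _).symm (diagFeed_snd hB _).symm

end Main

end RowContraction

end

theorem mainTheorem4 {n : ℕ} (P : Set (FreeAlgebra ℂ (Fin n)))
    {H₁ H₂ F F' : Type*}
    [NormedAddCommGroup H₁] [InnerProductSpace ℂ H₁] [CompleteSpace H₁]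
    [NormedAddCommGroup H₂] [InnerProductSpace ℂ H₂] [CompleteSpace H₂]
    [NormedAddCommGroup F] [InnerProductSpace ℂ F] [CompleteSpace F]
    [NormedAddCommGroup F'] [InnerProductSpace ℂ F'] [CompleteSpace F']
    (he : RowContraction.vacuum n ∈ RowContraction.NJ P)
    (A : Fin n → H₁ →L[ℂ] H₁) (B : Fin n → H₂ →L[ℂ] H₂)
    (hA : RowContraction.IsConstrained P A) (hB : RowContraction.IsConstrained P B)
    (w : WithLp 2 (RowContraction.defTstar A × F) ≃ₗᵢ[ℂ] WithLp 2 (RowContraction.defT B × F'))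
    (hT : RowContraction.IsConstrained P
      (RowContraction.upperOf A B (RowContraction.corner w)))
    (hΘ : RowContraction.IsPurelyContractive P he (RowContraction.prodChar P A B w)) :
    RowContraction.Coincides P (RowContraction.prodChar P A B w)
      (RowContraction.consChar P (RowContraction.upperOf A B (RowContraction.corner w))) := by
  have hpure : ∀ η, η ≠ 0 → ‖RowContraction.cascadeFeed hA.1 hB.1 w η‖ < ‖η‖ := fun η hη => by
    have h := hΘ.2 η hη
    rwa [RowContraction.prodChar_vacuum he hA.1 hB.1, RowContraction.norm_tens_vacuum] at h
  obtain ⟨W, Ws, hW⟩ := RowContraction.exists_charFun_upperOf hA.1 hB.1 w hT.1 hpure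
  refine ⟨W, Ws, ContinuousLinearMap.ext fun z => ?_⟩
  -- The constrained characteristic function of `T` is by definition the compression of `charFun`,
  -- so the identity on the full Fock space descends to `N_J`.
  exact RowContraction.NAmpl_eq_compress_of_sub_mem (RowContraction.preservesMJ_charFun he hT.1)
    _ _ z _ (RowContraction.prodChar_sub_mem he hA.1 hB.1 w z) (hW z)
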